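/- Let $(X_t)_{t\ge 0}$ be a stochastic process on a probability space $(\Omega,\mathcal F,P)$ with values in $\mathbb R^d$ and almost surely continuous paths, extended by $X_t=0$ for $t<0$, and let $T>0$, $\alpha>0$. For $\varepsilon>0$ let $D_\varepsilon X_t$ be any one (fixed) of the discrete derivatives $$\frac{X_{t+\varepsilon}-X_t}{\varepsilon},\qquad \frac{X_t-X_{t-\varepsilon}}{\varepsilon},\qquad \frac{X_{t+\varepsilon}-X_{t-\varepsilon}}{\varepsilon},$$ and for every continuous vector field $\varphi:\mathbb R^d\to\mathbb R^d$ put $I_\varepsilon(\varphi)=\int_0^T\langle\varphi(X_t),D_\varepsilon X_t\rangle\,dt$. For $s\in\mathbb R$, let $(1-\Delta)^{s/2}$ be the Fourier multiplier on tempered distributional vector fields with symbol $(1+|\ell|^2)^{s/2}$ (for the Fourier transform with kernel $e^{-i\langle x,\ell\rangle}$), and let $H_2^s(\mathbb R^d)$ be the space of the ($\mathbb R^d$-valued) tempered distributional vector fields $u$ with $\|u\|_{H_2^s}:=\|(1-\Delta)^{s/2}u\|_{L^2}<\infty$. The dual of $H_2^{\alpha}$ is identified with $H_2^{-\alpha}$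 by the pairing $\langle u,\varphi\rangle=\int_{\mathbb R^d}\langle(1-\Delta)^{-\alpha/2}u(x),(1-\Delta)^{\alpha/2}\varphi(x)\rangle\,dx$, which for $\varphi\in C_0^\infty$ is the value $u(\varphi)$ of the distribution. Let $$K_\alpha(x)=\frac{1}{\Gamma(\alpha)(4\pi)^{d/2}}\int_0^\infty t^{\alpha-\frac d2}e^{-\frac{|x|^2}{4t}-t}\,\frac{dt}{t}$$ be the kernel of $(1-\Delta)^{-\alpha}$, let $\widehat K_\alpha(x)=K_\alpha(x)$ for $x\ne0$ and $\widehat K_\alpha(0)=\infty$, and let $$Z_{\alpha,\varepsilon}=\int_0^T\!\!\int_0^T K_\alpha(X_t-X_s)\,\langle D_\varepsilon X_t,D_\varepsilon X_s\rangle\,dt\,ds .$$ Assume: (A) for every smooth compactly supported vector field $\varphi\in C_0^\infty(\mathbb R^d)$, $I_\varepsilon(\varphi)$ converges in probability, as $\varepsilon\downarrow0$, to some random variable $I(\varphi)$; (B) $\int_0^T\int_0^T\widehat K_\alpha(X_t-X_s)\,dt\,ds<\infty$ almost surely; (C) $\sup_{\varepsilon\in(0,1)}E[Z_{\alpha,\varepsilon}]<\infty$.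 Then: (i) For every $\varepsilon\in(0,1)$, the maps $\varphi\mapsto I_\varepsilon(\varphi)$ and $\varphi\mapsto I(\varphi)$ on $C_0^\infty(\mathbb R^d)$ take values in $L^2(\Omega)$ and extend uniquely to continuous linear maps $H_2^\alpha(\mathbb R^d)\to L^2(\Omega)$, still denoted $I_\varepsilon$ and $I$. Moreover, for every $\varphi\in H_2^\alpha(\mathbb R^d)$, as $\varepsilon\downarrow0$, $I_\varepsilon(\varphi)\to I(\varphi)$ in probability and in $L^{2-\delta}(\Omega)$ for every $\delta\in(0,2)$. (ii) There exist random elements $\xi_\varepsilon$ ($\varepsilon\in(0,1)$) and $\xi$ of $H_2^{-\alpha}(\mathbb R^d)$, belonging to $L^2(\Omega;H_2^{-\alpha}(\mathbb R^d))$, that are pathwise redefinitions of $I_\varepsilon$ and $I$: for every $\varphi\in C_0^\infty(\mathbb R^d)$, $I_\varepsilon(\varphi)(\omega)=\xi_\varepsilon(\omega)(\varphi)$ and $I(\varphi)(\omega)=\xi(\omega)(\varphi)$ for $P$-a.e. $\omega$, and likewise, for every $\varphi\in H_2^\alpha(\mathbb R^d)$, $I_\varepsilon(\varphi)(\omega)=\langle\xi_\varepsilon(\omega),\varphi\rangle$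 and $I(\varphi)(\omega)=\langle\xi(\omega),\varphi\rangle$ for $P$-a.e. $\omega$. -/

import Mathlib

open MeasureTheory Filter Topology
open scoped SchwartzMap ENNReal NNReal

noncomputable section

namespace StochasticCurrents

/-- The Euclidean space `ℝ^d`. -/
abbrev RVec (d : ℕ) : Type := EuclideanSpace ℝ (Fin d)

/-- The Hermitian space `ℂ^d`, in which complexified vector fields take their values. -/
abbrev CVec (d : ℕ) : Type := EuclideanSpace ℂ (Fin d)

/-! ### The operators `(1 - Δ)^{s/2}` and the Sobolev spaces `H_2^s(ℝ^d)` of vector fields -/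

/-- The symbol of `(1 - Δ)^{s/2}`. Mathlib's Fourier transform uses the character
`exp (-2πi⟨x, ℓ⟩)`, so that `-Δ` is multiplication by `(2π)² ‖ℓ‖²`, and the symbol is
`(1 + (2π‖ℓ‖)²)^{s/2}`. -/
def besselSymbol (d : ℕ) (s : ℝ) (l : RVec d) : ℝ :=
  (1 + ‖(2 * Real.pi) • l‖ ^ 2) ^ (s / 2)

theorem besselSymbol_hasTemperateGrowth (d : ℕ) (s : ℝ) :
    (besselSymbol d s).HasTemperateGrowth := by
  have h := (Function.hasTemperateGrowth_one_add_norm_sq_rpow (RVec d) (s / 2)).comp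
    (((2 * Real.pi) • ContinuousLinearMap.id ℝ (RVec d)).hasTemperateGrowth)
  exact h

theorem besselSymbol_ofReal_hasTemperateGrowth (d : ℕ) (s : ℝ) :
    (fun l : RVec d ↦ (besselSymbol d s l : ℂ)).HasTemperateGrowth :=
  Complex.ofRealCLM.hasTemperateGrowth.comp (besselSymbol_hasTemperateGrowth d s)

/-- The pseudo-differential operator `Λ_s = (1 - Δ)^{s/2}` on tempered distributional fields. -/
def bessel (d : ℕ) (s : ℝ) : 𝓢'(RVec d, CVec d) →L[ℂ] 𝓢'(RVec d, CVec d) :=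
  TemperedDistribution.fourierMultiplierCLM (CVec d) (fun l ↦ (besselSymbol d s l : ℂ))

theorem bessel_neg_bessel (d : ℕ) (s : ℝ) (u : 𝓢'(RVec d, CVec d)) :
    bessel d (-s) (bessel d s u) = u := by
  unfold bessel
  rw [TemperedDistribution.fourierMultiplierCLM_fourierMultiplierCLM_apply
    (besselSymbol_ofReal_hasTemperateGrowth d s) (besselSymbol_ofReal_hasTemperateGrowth d (-s))]
  have h : ((fun l : RVec d ↦ (besselSymbol d s l : ℂ)) *
      fun l : RVec d ↦ (besselSymbol d (-s) l : ℂ)) = fun _ ↦ (1 : ℂ) := by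
    funext l
    simp only [Pi.mul_apply, besselSymbol]
    rw [← Complex.ofReal_mul, ← Real.rpow_add (by positivity)]
    simp [neg_div]
  rw [h]
  simp

/-- A `ℂ^d`-valued tempered distribution is *real* (that is, an `ℝ^d`-valued distributional
field) if it takes real values on real test functions. -/
def IsRealField {d : ℕ} (u : 𝓢'(RVec d, CVec d)) : Prop :=
  ∀ g : 𝓢(RVec d, ℂ), (∀ x, (g x).im = 0) → ∀ i : Fin d, (u g i).im = 0

/-- The space `L²` of (complexified) square integrable vector fields on `ℝ^d`. -/
abbrev L2Field (d : ℕ) : Type := Lp (CVec d) 2 (volume : Measure (RVec d))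

theorem L2Field.real_smul {d : ℕ} (c : ℝ) (f : L2Field d) : c • f = (c : ℂ) • f := by
  apply Lp.ext
  filter_upwards [Lp.coeFn_smul c f, Lp.coeFn_smul (c : ℂ) f] with x h1 h2
  rw [h1, h2]
  ext i
  simp

theorem distribution_real_smul {d : ℕ} (c : ℝ) (u : 𝓢'(RVec d, CVec d)) :
    c • u = (c : ℂ) • u := by
  ext φ i
  simp

theorem L2Field.toDistribution_injective {d : ℕ} {f g : L2Field d}
    (h : (f : 𝓢'(RVec d, CVec d)) = (g : 𝓢'(RVec d, CVec d))) : f = g := by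
  have hk := Lp.ker_toTemperedDistributionCLM_eq_bot (F := CVec d)
    (μ := (volume : Measure (RVec d))) (p := 2)
  exact LinearMap.ker_eq_bot.1 hk h

theorem L2Field.toDistribution_add {d : ℕ} (f g : L2Field d) :
    ((f + g : L2Field d) : 𝓢'(RVec d, CVec d)) = (f : 𝓢'(RVec d, CVec d)) + g :=
  map_add (Lp.toTemperedDistributionCLM (CVec d) volume 2) f g

theorem L2Field.toDistribution_smul {d : ℕ} (c : ℂ) (f : L2Field d) :
    ((c • f : L2Field d) : 𝓢'(RVec d, CVec d)) = c • (f : 𝓢'(RVec d, CVec d)) :=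
  map_smul (Lp.toTemperedDistributionCLM (CVec d) volume 2) c f

/-- The tempered distributional vector fields `u` (real) such that `(1 - Δ)^{s/2} u ∈ L²`. -/
def sobolevSubmodule (d : ℕ) (s : ℝ) : Submodule ℝ 𝓢'(RVec d, CVec d) where
  carrier := {u | IsRealField u ∧ ∃ f : L2Field d, bessel d s u = (f : 𝓢'(RVec d, CVec d))}
  zero_mem' := ⟨fun g _ i ↦ by simp, 0,
    (map_zero (bessel d s)).trans
      (map_zero (Lp.toTemperedDistributionCLM (CVec d) volume 2)).symm⟩
  add_mem' := by
    rintro u v ⟨hu, f, hf⟩ ⟨hv, g, hg⟩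
    refine ⟨fun φ hφ i ↦ by simp [hu φ hφ i, hv φ hφ i], f + g, ?_⟩
    rw [map_add, hf, hg, L2Field.toDistribution_add]
  smul_mem' := by
    rintro c u ⟨hu, f, hf⟩
    refine ⟨fun φ hφ i ↦ by simp [hu φ hφ i], (c : ℂ) • f, ?_⟩
    rw [distribution_real_smul, map_smul, hf, L2Field.toDistribution_smul]

/-- The Sobolev space `H_2^s(ℝ^d)` of vector fields. It is a type of its own, since its topology is
the one of the norm `‖(1 - Δ)^{s/2} u‖_{L²}`, not the one of tempered distributions. -/
def Sobolev (d : ℕ) (s : ℝ) : Type := sobolevSubmodule d s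

namespace Sobolev

instance instAddCommGroup (d : ℕ) (s : ℝ) : AddCommGroup (Sobolev d s) :=
  inferInstanceAs (AddCommGroup (sobolevSubmodule d s))

instance instModule (d : ℕ) (s : ℝ) : Module ℝ (Sobolev d s) :=
  inferInstanceAs (Module ℝ (sobolevSubmodule d s))

/-- The tempered distribution underlying an element of `H_2^s`. -/
def toDistribution {d : ℕ} {s : ℝ} : Sobolev d s →ₗ[ℝ] 𝓢'(RVec d, CVec d) :=
  (sobolevSubmodule d s).subtype

theorem toDistribution_injective {d : ℕ} {s : ℝ} :
    Function.Injective (toDistribution : Sobolev d s →ₗ[ℝ] 𝓢'(RVec d, CVec d)) :=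
  Subtype.coe_injective

theorem exists_repr {d : ℕ} {s : ℝ} (u : Sobolev d s) :
    ∃ f : L2Field d, bessel d s (toDistribution u) = (f : 𝓢'(RVec d, CVec d)) :=
  u.2.2

/-- The square integrable field `(1 - Δ)^{s/2} u`, for `u ∈ H_2^s`. -/
def besselL2 {d : ℕ} {s : ℝ} : Sobolev d s →ₗ[ℝ] L2Field d where
  toFun u := (exists_repr u).choose
  map_add' u v := by
    apply L2Field.toDistribution_injective
    exact (exists_repr (u + v)).choose_spec.symm.trans
      ((by rw [map_add, map_add] : bessel d s (toDistribution (u + v)) =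
          bessel d s (toDistribution u) + bessel d s (toDistribution v)).trans
        ((congrArg₂ (· + ·) (exists_repr u).choose_spec (exists_repr v).choose_spec).trans
          (L2Field.toDistribution_add _ _).symm))
  map_smul' c u := by
    apply L2Field.toDistribution_injective
    rw [RingHom.id_apply, L2Field.real_smul]
    exact (exists_repr (c • u)).choose_spec.symm.trans
      ((by rw [map_smul, distribution_real_smul, map_smul] :
          bessel d s (toDistribution (c • u)) =
            (c : ℂ) • bessel d s (toDistribution u)).trans
        ((congrArg ((c : ℂ) • ·) (exists_repr u).choose_spec).trans
          (L2Field.toDistribution_smul _ _).symm))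

theorem besselL2_spec {d : ℕ} {s : ℝ} (u : Sobolev d s) :
    bessel d s (toDistribution u) = (besselL2 u : 𝓢'(RVec d, CVec d)) :=
  (exists_repr u).choose_spec

theorem besselL2_injective {d : ℕ} {s : ℝ} :
    Function.Injective (besselL2 : Sobolev d s →ₗ[ℝ] L2Field d) := by
  intro u v h
  apply toDistribution_injective
  rw [← bessel_neg_bessel d s (toDistribution u), ← bessel_neg_bessel d s (toDistribution v),
    besselL2_spec, besselL2_spec, h]

/-- The norm `‖u‖_{H_2^s} = ‖(1 - Δ)^{s/2} u‖_{L²}`. -/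
instance instNormedAddCommGroup (d : ℕ) (s : ℝ) : NormedAddCommGroup (Sobolev d s) :=
  NormedAddCommGroup.induced (Sobolev d s) (L2Field d) besselL2 besselL2_injective

instance instNormedSpace (d : ℕ) (s : ℝ) : NormedSpace ℝ (Sobolev d s) :=
  NormedSpace.induced ℝ (Sobolev d s) (L2Field d) besselL2

theorem norm_eq {d : ℕ} {s : ℝ} (u : Sobolev d s) : ‖u‖ = ‖besselL2 u‖ := rfl

/-- The duality between `H_2^{-s}` and `H_2^s`:
`⟨u, φ⟩ = ∫ ⟨(1 - Δ)^{-s/2} u (x), (1 - Δ)^{s/2} φ (x)⟩ dx`. Both fields are real, so the `L²` inner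
product is real; taking its real part only changes the type. -/
def dualPairing (d : ℕ) (s : ℝ) : Sobolev d (-s) →L[ℝ] (Sobolev d s →L[ℝ] ℝ) :=
  LinearMap.mkContinuous₂
    (LinearMap.mk₂ ℝ (fun u φ ↦ (inner ℂ (besselL2 u) (besselL2 φ)).re)
      (fun u v φ ↦ by simp [inner_add_left])
      (fun c u φ ↦ by
        rw [map_smul, L2Field.real_smul, inner_smul_left]
        simp)
      (fun u φ ψ ↦ by simp [inner_add_right])
      (fun c u φ ↦ by
        rw [map_smul, L2Field.real_smul, inner_smul_right]
        simp))
    1 (fun u φ ↦ by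
      rw [one_mul, norm_eq, norm_eq]
      exact (Complex.abs_re_le_norm _).trans (norm_inner_le_norm _ _))

end Sobolev

/-! ### Smooth compactly supported vector fields -/

/-- The smooth compactly supported vector fields `φ : ℝ^d → ℝ^d`. -/
structure TestField (d : ℕ) where
  /-- The underlying map. -/
  toFun : RVec d → RVec d
  smooth : ContDiff ℝ (⊤ : ℕ∞) toFun
  compactSupport : HasCompactSupport toFun

namespace TestField

/-- The coordinatewise inclusion `ℝ^d → ℂ^d`. -/
def complexify (d : ℕ) : RVec d →L[ℝ] CVec d :=
  LinearMap.toContinuousLinearMap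
    { toFun := fun v ↦ WithLp.toLp 2 (fun i ↦ (v i : ℂ))
      map_add' := fun v w ↦ by ext i; simp
      map_smul' := fun c v ↦ by ext i; simp }

@[simp] theorem complexify_apply {d : ℕ} (v : RVec d) (i : Fin d) :
    complexify d v i = (v i : ℂ) := rfl

/-- A test field, as a Schwartz function with values in `ℂ^d`. -/
def toSchwartz {d : ℕ} (φ : TestField d) : 𝓢(RVec d, CVec d) :=
  HasCompactSupport.toSchwartzMap (f := fun x ↦ complexify d (φ.toFun x))
    (φ.compactSupport.comp_left (map_zero _)) ((complexify d).contDiff.comp φ.smooth)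

/-- The `i`-th coordinate of a test field, as a scalar Schwartz function. -/
def component {d : ℕ} (φ : TestField d) (i : Fin d) : 𝓢(RVec d, ℂ) :=
  HasCompactSupport.toSchwartzMap (f := fun x ↦ (φ.toFun x i : ℂ))
    (φ.compactSupport.comp_left (g := fun v : RVec d ↦ (v i : ℂ)) (by simp))
    (Complex.ofRealCLM.contDiff.comp
      (((EuclideanSpace.proj i : RVec d →L[ℝ] ℝ)).contDiff.comp φ.smooth))

/-- A test field, as a tempered distribution, belongs to every space `H_2^s`. -/
theorem mem_sobolevSubmodule {d : ℕ} (φ : TestField d) (s : ℝ) :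
    (φ.toSchwartz : 𝓢'(RVec d, CVec d)) ∈ sobolevSubmodule d s := by
  refine ⟨fun g hg i ↦ ?_, ?_⟩
  · rw [SchwartzMap.coe_apply]
    have hint : Integrable (fun x ↦ g x • φ.toSchwartz x) :=
      (SchwartzMap.pairing (ContinuousLinearMap.lsmul ℂ ℂ).flip φ.toSchwartz g).integrable
    have h1 : (∫ x, g x • φ.toSchwartz x) i = ∫ x, (g x • φ.toSchwartz x) i :=
      (((EuclideanSpace.proj i : CVec d →L[ℂ] ℂ)).integral_comp_comm hint).symm
    have h2 : (fun x ↦ (g x • φ.toSchwartz x) i) =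
        fun x ↦ (((g x).re * φ.toFun x i : ℝ) : ℂ) := by
      funext x
      change g x * (φ.toFun x i : ℂ) = _
      apply Complex.ext <;> simp [hg x]
    rw [h1, h2, integral_complex_ofReal]
    exact Complex.ofReal_im _
  · refine ⟨(SchwartzMap.fourierMultiplierCLM (CVec d)
      (fun l ↦ (besselSymbol d s l : ℂ)) φ.toSchwartz).toLp 2, ?_⟩
    rw [bessel, Lp.toTemperedDistribution_toLp_eq,
      TemperedDistribution.fourierMultiplierCLM_toTemperedDistributionCLM_eq
        (besselSymbol_ofReal_hasTemperateGrowth d s)]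

/-- The inclusion of the test fields in `H_2^s`. -/
def toSobolev {d : ℕ} (s : ℝ) (φ : TestField d) : Sobolev d s :=
  ⟨φ.toSchwartz, φ.mem_sobolevSubmodule s⟩

end TestField

/-- The value `u(φ) = ∑ᵢ uᵢ(φᵢ)` of a distributional field `u` at a test field `φ`. -/
def evalTest {d : ℕ} (u : 𝓢'(RVec d, CVec d)) (φ : TestField d) : ℝ :=
  ∑ i : Fin d, (u (φ.component i) i).re

/-! ### The Bessel kernel -/

/-- The kernel `K_α` of `(1 - Δ)^{-α}`,
`K_α(x) = (Γ(α) (4π)^{d/2})⁻¹ ∫_0^∞ t^{α - d/2} e^{-|x|²/(4t) - t} dt/t`. -/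
def besselKernel (d : ℕ) (α : ℝ) (x : RVec d) : ℝ :=
  (Real.Gamma α * (4 * Real.pi) ^ ((d : ℝ) / 2))⁻¹ *
    ∫ t in Set.Ioi (0 : ℝ), t ^ (α - (d : ℝ) / 2) * Real.exp (-‖x‖ ^ 2 / (4 * t) - t) / t

open Classical in
/-- The function `K̂_α`, equal to `K_α` off the origin and to `∞` at the origin. -/
def besselKernelHat (d : ℕ) (α : ℝ) (x : RVec d) : ℝ≥0∞ :=
  if x = 0 then ∞ else ENNReal.ofReal (besselKernel d α x)

/-! ### Regularized integrals -/

/-- The three discrete derivatives. -/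
inductive Scheme where
  /-- `(X_{t+ε} - X_t)/ε` -/
  | forward
  /-- `(X_t - X_{t-ε})/ε` -/
  | backward
  /-- `(X_{t+ε} - X_{t-ε})/ε` -/
  | symmetric

variable {Ω : Type*} {d : ℕ}

/-- The process extended by `0` to negative times. -/
def extend (X : ℝ≥0 → Ω → RVec d) (t : ℝ) (ω : Ω) : RVec d :=
  if 0 ≤ t then X t.toNNReal ω else 0

/-- The discrete derivative `D_ε X_t`. -/
def discreteDeriv (D : Scheme) (X : ℝ≥0 → Ω → RVec d) (ε t : ℝ) (ω : Ω) : RVec d :=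
  match D with
  | .forward => ε⁻¹ • (extend X (t + ε) ω - extend X t ω)
  | .backward => ε⁻¹ • (extend X t ω - extend X (t - ε) ω)
  | .symmetric => ε⁻¹ • (extend X (t + ε) ω - extend X (t - ε) ω)

/-- The regularized integral `I_ε(φ) = ∫_0^T ⟨φ(X_t), D_ε X_t⟩ dt`. -/
def regIntegral (D : Scheme) (X : ℝ≥0 → Ω → RVec d) (T ε : ℝ) (φ : TestField d) (ω : Ω) : ℝ :=
  ∫ t in (0 : ℝ)..T, inner ℝ (φ.toFun (extend X t ω)) (discreteDeriv D X ε t ω)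

/-- The double integral
`Z_{α,ε} = ∫_0^T ∫_0^T K_α(X_t - X_s) ⟨D_ε X_t, D_ε X_s⟩ dt ds`. -/
def energy (D : Scheme) (X : ℝ≥0 → Ω → RVec d) (T α ε : ℝ) (ω : Ω) : ℝ :=
  ∫ s in (0 : ℝ)..T, ∫ t in (0 : ℝ)..T,
    besselKernel d α (extend X t ω - extend X s ω) *
      inner ℝ (discreteDeriv D X ε t ω) (discreteDeriv D X ε s ω)

variable [MeasurableSpace Ω]

/-- `∫_0^T ∫_0^T K̂_α(X_t - X_s) dt ds < ∞` almost surely. -/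
def KernelIntegrable (P : Measure Ω) (X : ℝ≥0 → Ω → RVec d) (T α : ℝ) : Prop :=
  ∀ᵐ ω ∂P, (∫⁻ s in Set.Icc 0 T, ∫⁻ t in Set.Icc 0 T,
    besselKernelHat d α (extend X t ω - extend X s ω)) < ∞

/-- The regularized integrals converge (limits named): for every test field `φ`, `I_ε(φ)` converges in
probability, as `ε ↓ 0`, to the random variable `I(φ)`. -/
def RegIntegralsConverge (P : Measure Ω) (D : Scheme) (X : ℝ≥0 → Ω → RVec d) (T : ℝ)
    (I : TestField d → Ω → ℝ) : Prop :=
  ∀ φ : TestField d, AEMeasurable (I φ) P ∧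
    TendstoInMeasure P (fun ε ω ↦ regIntegral D X T ε φ ω) (𝓝[>] (0 : ℝ)) (I φ)

/-- The map `F`, from test fields to random variables, takes values in `L²(Ω)`, and `J` is the unique
continuous linear map `H_2^α → L²(Ω)` that extends it. -/
def IsUniqueExtension (P : Measure Ω) (α : ℝ) (F : TestField d → Ω → ℝ)
    (J : Sobolev d α →L[ℝ] Lp ℝ 2 P) : Prop :=
  (∀ φ : TestField d, MemLp (F φ) 2 P) ∧
  (∀ φ : TestField d, J (φ.toSobolev α) =ᵐ[P] F φ) ∧
  ∀ J' : Sobolev d α →L[ℝ] Lp ℝ 2 P,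
    (∀ φ : TestField d, J' (φ.toSobolev α) =ᵐ[P] F φ) → J' = J

/-- `ξ` is a random element of `H_2^{-α}`, belongs to `L²(Ω; H_2^{-α})`, and is a pathwise
redefinition of `F`, and of its extension `J`: for every test field `φ`, almost surely
`F(φ)(ω) = ξ(ω)(φ)`, and for every `φ ∈ H_2^α`, almost surely `J(φ)(ω) = ⟨ξ(ω), φ⟩`. -/
def IsPathwiseRedefinition (P : Measure Ω) (α : ℝ) (F : TestField d → Ω → ℝ)
    (J : Sobolev d α →L[ℝ] Lp ℝ 2 P) (ξ : Ω → Sobolev d (-α)) : Prop :=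
  StronglyMeasurable ξ ∧ MemLp ξ 2 P ∧
  (∀ φ : TestField d, ∀ᵐ ω ∂P, F φ ω = evalTest (Sobolev.toDistribution (ξ ω)) φ) ∧
  ∀ φ : Sobolev d α, ∀ᵐ ω ∂P, J φ ω = Sobolev.dualPairing d α (ξ ω) φ

end StochasticCurrents

end

open StochasticCurrents

/-! Fix a path. Its discrete derivative `v` is bounded on `(0, T]`, so `φ ↦ ∫ ⟨φ(x_s), v_s⟩ ds` is a
vector measure with Fourier transform `F(l) = ∫ e^{-2πi⟨x_s, l⟩} v_s ds`. The symbol of `(1 -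
Δ)^{-α}` is a Gamma mixture of Gaussians, and transforming each Gaussian turns `∫ (1 + |2πl|²)^{-α}
|F(l)|² dl` into the double integral of `K_α(x_t - x_s) ⟨v_t, v_s⟩`, that is, into the energy `Z`
(`lintegral_symbol_mul_norm_sq_pathFourier`). Assumption (B) is what licenses Fubini here. Parseval
and Cauchy–Schwarz then give the pathwise bound `|I_ε(φ)| ≤ √Z ‖φ‖` in the norm of `H_2^α`
(`abs_integral_inner_le`).

The rest is Hilbert space theory (`exists_random_functionals`). Integrating the squared bound gives
`E|I_ε(φ)|² ≤ C ‖φ‖²`, hence the extension. One random constant `Z` serves all `φ` at once, so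
Bessel's inequality holds path by path, and integrating it gives the stronger Hilbert–Schmidt bound
`∑ E|I_ε(b_n)|² ≤ C` for orthonormal `b`. Such a map is represented by the vector `ξ = ∑ I_ε(b_n)
b_n` of `L²(Ω; H)` (`exists_random_vector`), which spares any separate proof that a pathwise dual
element is measurable. The `b_n` need not be test fields, so Bessel's inequality is first proved for
test fields near them and then passed to the limit.

Both bounds survive limits in probability, by Fatou. Convergence spreads from test fields to all of
`H_2^α` by density and the uniform `L²` bound, and holds in `L^p` for `p < 2` by Hölder's inequality
on the small sets of large deviation.

The isometries `(1 - Δ)^{±α/2}` carry both `H_2^{±α}` to the one space `realL2 d`, where the duality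
is the inner product. -/

noncomputable section

namespace StochasticCurrents

open FourierTransform ComplexConjugate

/-! ### Bessel potentials of Schwartz functions -/

/-- The operator `(1 - Δ)^{s/2}` on Schwartz functions. -/
def schwartzBessel (d : ℕ) (s : ℝ) (F : Type*) [NormedAddCommGroup F] [NormedSpace ℂ F] :
    𝓢(RVec d, F) →L[ℂ] 𝓢(RVec d, F) :=
  SchwartzMap.fourierMultiplierCLM F (fun l ↦ (besselSymbol d s l : ℂ))

theorem besselSymbol_neg {d : ℕ} (s : ℝ) (l : RVec d) :
    besselSymbol d s (-l) = besselSymbol d s l := by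
  simp [besselSymbol]

theorem besselSymbol_pos {d : ℕ} (s : ℝ) (l : RVec d) : 0 < besselSymbol d s l := by
  unfold besselSymbol
  positivity

theorem smulLeftCLM_besselSymbol_apply {d : ℕ} (s : ℝ) {F : Type*} [NormedAddCommGroup F]
    [NormedSpace ℂ F] (g : 𝓢(RVec d, F)) (l : RVec d) :
    SchwartzMap.smulLeftCLM F (fun l ↦ (besselSymbol d s l : ℂ)) g l =
      (besselSymbol d s l : ℂ) • g l :=
  SchwartzMap.smulLeftCLM_apply_apply (besselSymbol_ofReal_hasTemperateGrowth d s) g l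

theorem schwartzBessel_apply {d : ℕ} (s : ℝ) {F : Type*} [NormedAddCommGroup F]
    [NormedSpace ℂ F] (g : 𝓢(RVec d, F)) (x : RVec d) :
    schwartzBessel d s F g x =
      𝓕⁻ (fun l ↦ (besselSymbol d s l : ℂ) • 𝓕 (g : RVec d → F) l) x := by
  rw [schwartzBessel, SchwartzMap.fourierMultiplierCLM_apply, SchwartzMap.fourierInv_coe]
  refine congrFun (congrArg _ (funext fun l ↦ ?_)) x
  rw [smulLeftCLM_besselSymbol_apply, SchwartzMap.fourier_coe]

/-- As the symbol is even, the two Fourier transforms may be exchanged. -/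
theorem fourier_symbol_fourierInv {d : ℕ} (s : ℝ) {F : Type*} [NormedAddCommGroup F]
    [NormedSpace ℂ F] (g : 𝓢(RVec d, F)) :
    𝓕 (SchwartzMap.smulLeftCLM F (fun l ↦ (besselSymbol d s l : ℂ)) (𝓕⁻ g)) =
      schwartzBessel d s F g := by
  ext x
  rw [schwartzBessel_apply, SchwartzMap.fourier_coe, Real.fourierInv_eq_fourier_comp_neg]
  refine congrFun (congrArg _ (funext fun l ↦ ?_)) x
  rw [smulLeftCLM_besselSymbol_apply, besselSymbol_neg, SchwartzMap.fourierInv_coe,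
    Real.fourierInv_eq_fourier_neg]

/-- Transposition leaves the two Fourier transforms on `g` in the opposite order; evenness of the
symbol restores the usual one. -/
theorem bessel_apply {d : ℕ} (s : ℝ) (u : 𝓢'(RVec d, CVec d)) (g : 𝓢(RVec d, ℂ)) :
    bessel d s u g = u (schwartzBessel d s ℂ g) := by
  rw [← fourier_symbol_fourierInv]
  rfl

theorem conj_fourier {d : ℕ} (f : RVec d → ℂ) (x : RVec d) :
    conj (𝓕 f x) = 𝓕⁻ (fun l ↦ conj (f l)) x := by
  rw [Real.fourier_eq, Real.fourierInv_eq, ← integral_conj]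
  congr 1
  funext l
  simp [Circle.smul_def, ← Circle.coe_inv_eq_conj, AddChar.map_neg_eq_inv]

theorem conj_fourierInv {d : ℕ} (f : RVec d → ℂ) (x : RVec d) :
    conj (𝓕⁻ f x) = 𝓕 (fun l ↦ conj (f l)) x := by
  rw [Real.fourier_eq, Real.fourierInv_eq, ← integral_conj]
  congr 1
  funext l
  simp [Circle.smul_def, ← Circle.coe_inv_eq_conj, AddChar.map_neg_eq_inv]

/-- Conjugation exchanges `𝓕` and `𝓕⁻` and fixes the real symbol; since the symbol is even, the
exchanged expression is the original one. -/
theorem schwartzBessel_im_eq_zero {d : ℕ} (s : ℝ) (g : 𝓢(RVec d, ℂ)) (hg : ∀ x, (g x).im = 0)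
    (x : RVec d) : (schwartzBessel d s ℂ g x).im = 0 := by
  have hgc : (fun y ↦ conj (g y)) = (g : RVec d → ℂ) := by
    funext y
    exact Complex.conj_eq_iff_im.2 (hg y)
  rw [← Complex.conj_eq_iff_im]
  nth_rewrite 1 [schwartzBessel_apply]
  rw [conj_fourierInv, ← fourier_symbol_fourierInv, SchwartzMap.fourier_coe]
  refine congrFun (congrArg _ (funext fun l ↦ ?_)) x
  rw [smulLeftCLM_besselSymbol_apply, SchwartzMap.fourierInv_coe, smul_eq_mul, smul_eq_mul,
    map_mul, Complex.conj_ofReal, conj_fourier, hgc]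

theorem IsRealField.bessel {d : ℕ} {u : 𝓢'(RVec d, CVec d)} (hu : IsRealField u) (s : ℝ) :
    IsRealField (bessel d s u) := fun g hg i ↦ by
  rw [bessel_apply]
  exact hu _ (schwartzBessel_im_eq_zero s g hg) i

/-- The `i`-th coordinate of a Schwartz field. -/
abbrev schwartzCoord {d : ℕ} (i : Fin d) : 𝓢(RVec d, CVec d) →L[ℂ] 𝓢(RVec d, ℂ) :=
  SchwartzMap.postcompCLM (EuclideanSpace.proj i : CVec d →L[ℂ] ℂ)

theorem fourier_schwartzCoord {d : ℕ} (g : 𝓢(RVec d, CVec d)) (i : Fin d) :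
    𝓕 (schwartzCoord i g) = schwartzCoord i (𝓕 g) := by
  ext l
  rw [SchwartzMap.postcompCLM_apply, SchwartzMap.fourier_coe, SchwartzMap.fourier_coe,
    Real.fourier_eq, Real.fourier_eq]
  have hint : Integrable (fun v ↦ Real.fourierChar (-(inner ℝ v l)) • g v) := by
    rw [← integrable_norm_iff]
    · simpa using g.integrable.norm
    · apply Continuous.aestronglyMeasurable
      have := g.continuous
      have := Real.continuous_fourierChar
      fun_prop
  exact ((EuclideanSpace.proj i : CVec d →L[ℂ] ℂ)).integral_comp_comm hint

theorem fourierInv_schwartzCoord {d : ℕ} (g : 𝓢(RVec d, CVec d)) (i : Fin d) :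
    𝓕⁻ (schwartzCoord i g) = schwartzCoord i (𝓕⁻ g) := by
  have h := fourier_schwartzCoord (𝓕⁻ g) i
  rw [FourierTransform.fourier_fourierInv_eq] at h
  rw [← h, FourierTransform.fourierInv_fourier_eq]

/-- Distributions are tested on scalar functions, whereas Sobolev norms see whole fields; this
passes between the two. -/
theorem schwartzBessel_schwartzCoord {d : ℕ} (s : ℝ) (g : 𝓢(RVec d, CVec d)) (i : Fin d) :
    schwartzBessel d s ℂ (schwartzCoord i g) = schwartzCoord i (schwartzBessel d s (CVec d) g) := by
  rw [schwartzBessel, schwartzBessel, SchwartzMap.fourierMultiplierCLM_apply,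
    SchwartzMap.fourierMultiplierCLM_apply, fourier_schwartzCoord, ← fourierInv_schwartzCoord]
  congr 1
  ext l
  simp [smulLeftCLM_besselSymbol_apply]

theorem TestField.component_eq {d : ℕ} (φ : TestField d) (i : Fin d) :
    φ.component i = schwartzCoord i φ.toSchwartz := rfl

/-! ### The Hilbert space of real square integrable fields -/

/-- The real square integrable fields. -/
def realL2 (d : ℕ) : Submodule ℝ (L2Field d) where
  carrier := {f | IsRealField (f : 𝓢'(RVec d, CVec d))}
  zero_mem' := fun g _ i ↦ by
    rw [show ((0 : L2Field d) : 𝓢'(RVec d, CVec d)) = 0 from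
      map_zero (Lp.toTemperedDistributionCLM (CVec d) volume 2)]
    simp
  add_mem' := by
    intro u v hu hv φ hφ i
    rw [L2Field.toDistribution_add]
    exact (congrArg₂ (· + ·) (hu φ hφ i) (hv φ hφ i)).trans (add_zero 0)
  smul_mem' := by
    intro c u hu φ hφ i
    rw [L2Field.real_smul, L2Field.toDistribution_smul]
    exact (Complex.im_ofReal_mul c _).trans ((congrArg (c * ·) (hu φ hφ i)).trans (mul_zero c))

/-- Completeness follows, as needed for orthogonal complements and Hilbert bases. -/
theorem isClosed_realL2 (d : ℕ) : IsClosed (realL2 d : Set (L2Field d)) := by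
  have : (realL2 d : Set (L2Field d)) = ⋂ (g : 𝓢(RVec d, ℂ)) (_ : ∀ x, (g x).im = 0) (i : Fin d),
      {f | ((Lp.toTemperedDistributionCLM (CVec d) volume 2 f) g i).im = 0} := by
    ext f
    simp only [Set.mem_iInter]
    rfl
  rw [this]
  refine isClosed_iInter fun g ↦ isClosed_iInter fun _ ↦ isClosed_iInter fun i ↦ ?_
  refine isClosed_eq ?_ continuous_const
  have h : Continuous fun f : L2Field d ↦ (Lp.toTemperedDistributionCLM (CVec d) volume 2 f) g := by
    have := (Lp.toTemperedDistributionCLM (CVec d) (volume : Measure (RVec d)) 2).continuous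
    fun_prop
  exact Complex.continuous_im.comp ((EuclideanSpace.proj i : CVec d →L[ℂ] ℂ).continuous.comp h)

instance (d : ℕ) : CompleteSpace (realL2 d) :=
  (isClosed_realL2 d).completeSpace_coe

/-- `(1 - Δ)^{s/2}` is an isometry of `H_2^s` onto the real square integrable fields. -/
def sobolevEquiv (d : ℕ) (s : ℝ) : Sobolev d s ≃ₗᵢ[ℝ] realL2 d :=
  LinearIsometryEquiv.ofSurjective
    { toLinearMap := Sobolev.besselL2.codRestrict (realL2 d) fun u ↦ by
        change IsRealField _
        rw [← Sobolev.besselL2_spec]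
        exact IsRealField.bessel u.2.1 s
      norm_map' := fun u ↦ rfl }
    (by
      intro f
      have h : bessel d s (bessel d (-s) ((f : L2Field d) : 𝓢'(RVec d, CVec d))) =
          ((f : L2Field d) : 𝓢'(RVec d, CVec d)) := by
        simpa using bessel_neg_bessel d (-s) ((f : L2Field d) : 𝓢'(RVec d, CVec d))
      let u : Sobolev d s := ⟨bessel d (-s) ((f : L2Field d) : 𝓢'(RVec d, CVec d)),
        IsRealField.bessel f.2 (-s), f, h⟩
      refine ⟨u, Subtype.ext (L2Field.toDistribution_injective ?_)⟩
      exact (Sobolev.besselL2_spec u).symm.trans h)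

theorem L2Field.inner_real {d : ℕ} (f g : L2Field d) : inner ℝ f g = (inner ℂ f g).re := by
  rw [L2.inner_def, L2.inner_def]
  have h := L2.integrable_inner (𝕜 := ℂ) f g
  rw [← RCLike.re_eq_complex_re, ← integral_re h]
  congr 1
  funext x
  simp [PiLp.inner_apply, Complex.inner]

/-- This is the bridge that turns a random vector of `realL2 d` into a random element of the dual
Sobolev space. -/
theorem dualPairing_eq_inner {d : ℕ} {s : ℝ} (u : Sobolev d (-s)) (φ : Sobolev d s) :
    Sobolev.dualPairing d s u φ = inner ℝ (sobolevEquiv d (-s) u) (sobolevEquiv d s φ) := by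
  rw [Submodule.coe_inner, L2Field.inner_real]
  rfl

theorem besselL2_toSobolev {d : ℕ} (s : ℝ) (φ : TestField d) :
    Sobolev.besselL2 (φ.toSobolev s) = (schwartzBessel d s (CVec d) φ.toSchwartz).toLp 2 := by
  apply L2Field.toDistribution_injective
  rw [← Sobolev.besselL2_spec, Lp.toTemperedDistribution_toLp_eq]
  exact TemperedDistribution.fourierMultiplierCLM_toTemperedDistributionCLM_eq
        (besselSymbol_ofReal_hasTemperateGrowth d s) _

theorem integrable_schwartz_smul_L2 {d : ℕ} (g : 𝓢(RVec d, ℂ)) (f : L2Field d) :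
    Integrable (fun x ↦ g x • f x) :=
  memLp_one_iff_integrable.1 ((Lp.memLp f).smul (g.memLp 2))

/-- Write `u = (1 - Δ)^{s/2} f` with `f ∈ L²` and move the operator onto `φ`. As `(1 - Δ)^{s/2} φ`
is real, the conjugate that the Hermitian product puts on `f` does not affect real parts. -/
theorem dualPairing_toSobolev {d : ℕ} {s : ℝ} (u : Sobolev d (-s)) (φ : TestField d) :
    Sobolev.dualPairing d s u (φ.toSobolev s) = evalTest (Sobolev.toDistribution u) φ := by
  have h1 : ∀ i, Sobolev.toDistribution u (φ.component i) i =
      ∫ x, schwartzBessel d s (CVec d) φ.toSchwartz x i * Sobolev.besselL2 u x i := by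
    intro i
    have h : Sobolev.toDistribution u = bessel d s (Sobolev.besselL2 u : 𝓢'(RVec d, CVec d)) := by
      rw [← Sobolev.besselL2_spec]
      simpa using (bessel_neg_bessel d (-s) (Sobolev.toDistribution u)).symm
    rw [h, bessel_apply, Lp.toTemperedDistribution_apply]
    rw [TestField.component_eq, schwartzBessel_schwartzCoord]
    exact ((EuclideanSpace.proj i : CVec d →L[ℂ] ℂ).integral_comp_comm
      (integrable_schwartz_smul_L2 _ _)).symm
  have h2 : Sobolev.dualPairing d s u (φ.toSobolev s) =
      (inner ℂ (Sobolev.besselL2 u) (Sobolev.besselL2 (φ.toSobolev s))).re := rfl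
  have hint : ∀ i : Fin d, Integrable
      (fun x ↦ schwartzBessel d s (CVec d) φ.toSchwartz x i * Sobolev.besselL2 u x i) := by
    intro i
    exact (EuclideanSpace.proj i : CVec d →L[ℂ] ℂ).integrable_comp
      (integrable_schwartz_smul_L2 (schwartzCoord i (schwartzBessel d s (CVec d) φ.toSchwartz))
        (Sobolev.besselL2 u))
  have hre : ∀ i x, (schwartzBessel d s (CVec d) φ.toSchwartz x i).im = 0 := by
    intro i x
    have := schwartzBessel_im_eq_zero s (φ.component i) (fun x ↦ by
      change ((φ.toFun x i : ℂ)).im = 0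
      simp) x
    rwa [TestField.component_eq, schwartzBessel_schwartzCoord] at this
  rw [h2, besselL2_toSobolev, L2.inner_def, ← RCLike.re_eq_complex_re,
    ← integral_re (L2.integrable_inner _ _), evalTest]
  have h3 : ∀ i, (Sobolev.toDistribution u (φ.component i) i).re =
      ∫ x, (schwartzBessel d s (CVec d) φ.toSchwartz x i * Sobolev.besselL2 u x i).re := by
    intro i
    rw [h1, ← RCLike.re_eq_complex_re, ← integral_re (hint i)]
  simp_rw [h3]
  rw [← integral_finsetSum _ fun i _ ↦ by simpa using (hint i).re]
  apply integral_congr_ae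
  filter_upwards [SchwartzMap.coeFn_toLp (schwartzBessel d s (CVec d) φ.toSchwartz) 2] with x hx
  rw [hx, PiLp.inner_apply]
  simp [hre]

/-! ### Density of the test fields -/

/-- A smooth function with compact support, equal to `1` on the ball of radius `1`. -/
def bump (d : ℕ) : ContDiffBump (0 : RVec d) := ⟨1, 2, one_pos, one_lt_two⟩

/-- A smooth function with compact support, equal to `1` on the ball of radius `n + 1`. -/
def cutoff (d n : ℕ) (x : RVec d) : ℝ := bump d (((n : ℝ) + 1)⁻¹ • x)

theorem contDiff_cutoff (d n : ℕ) : ContDiff ℝ (⊤ : ℕ∞) (cutoff d n) :=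
  (bump d).contDiff.comp (contDiff_const_smul _)

theorem hasCompactSupport_cutoff (d n : ℕ) : HasCompactSupport (cutoff d n) :=
  (bump d).hasCompactSupport.comp_smul (by positivity)

theorem cutoff_eq_one {d n : ℕ} {x : RVec d} (hx : ‖x‖ < n + 1) : cutoff d n x = 1 := by
  apply (bump d).one_of_mem_closedBall
  rw [mem_closedBall_zero_iff, norm_smul, norm_inv, Real.norm_of_nonneg (by positivity)]
  exact inv_mul_le_one_of_le₀ hx.le (by positivity)

/-- The chain rule contributes `(n + 1)^{-i} ≤ 1`, so a seminorm of the unscaled bump bounds every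
`n`. -/
theorem exists_norm_iteratedFDeriv_cutoff_le (d i : ℕ) :
    ∃ C : ℝ, ∀ n x, ‖iteratedFDeriv ℝ i (cutoff d n) x‖ ≤ C := by
  let S : 𝓢(RVec d, ℝ) := (bump d).hasCompactSupport.toSchwartzMap (bump d).contDiff
  refine ⟨SchwartzMap.seminorm ℝ 0 i S, fun n x ↦ ?_⟩
  have h : iteratedFDeriv ℝ i (cutoff d n) x =
      (((n : ℝ) + 1)⁻¹) ^ i • iteratedFDeriv ℝ i (bump d) (((n : ℝ) + 1)⁻¹ • x) := by
    have := iteratedFDeriv_comp_const_smul (((n : ℝ) + 1)⁻¹)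
      ((bump d).contDiff (n := (i : ℕ∞)))
    exact congrFun this x
  rw [h, norm_smul, norm_pow, norm_inv, Real.norm_of_nonneg (by positivity)]
  have h1 : (((n : ℝ) + 1)⁻¹) ^ i ≤ 1 :=
    pow_le_one₀ (by positivity) (inv_le_one_of_one_le₀ (by simp))
  have h2 : ‖iteratedFDeriv ℝ i (bump d) (((n : ℝ) + 1)⁻¹ • x)‖ ≤ SchwartzMap.seminorm ℝ 0 i S :=
    SchwartzMap.norm_iteratedFDeriv_le_seminorm ℝ S i _
  exact (mul_le_of_le_one_left (norm_nonneg _) h1).trans h2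

/-- The product of a cut-off and a Schwartz function. -/
def truncate {d : ℕ} (n : ℕ) (f : 𝓢(RVec d, ℂ)) : 𝓢(RVec d, ℂ) :=
  HasCompactSupport.toSchwartzMap (f := fun x ↦ cutoff d n x • f x)
    ((hasCompactSupport_cutoff d n).smul_right) ((contDiff_cutoff d n).smul (f.smooth _))

/-- The factor `cutoff - 1` vanishes for `‖x‖ < n + 1`. Elsewhere `1 ≤ ‖x‖ / (n + 1)`, so Leibniz'
rule and one more power of `‖x‖` in the seminorms of `f` give the rate. -/
theorem seminorm_truncate_sub_le {d : ℕ} (f : 𝓢(RVec d, ℂ)) (k m : ℕ) :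
    ∃ C : ℝ, ∀ n : ℕ, SchwartzMap.seminorm ℝ k m (truncate n f - f) ≤ C / (n + 1) := by
  choose c hc using exists_norm_iteratedFDeriv_cutoff_le d
  have hc0 : ∀ i, 0 ≤ c i := fun i ↦ (norm_nonneg _).trans (hc i 0 0)
  set A : ℝ := ∑ i ∈ Finset.range (m + 1), (m.choose i : ℝ) * (c i + 1) *
    SchwartzMap.seminorm ℝ (k + 1) (m - i) f
  have hA : 0 ≤ A := Finset.sum_nonneg fun i _ ↦ by have := hc0 i; positivity
  refine ⟨A, fun n ↦ SchwartzMap.seminorm_le_bound ℝ k m _ (by positivity) fun x ↦ ?_⟩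
  have hfun : ((truncate n f - f : 𝓢(RVec d, ℂ)) : RVec d → ℂ) =
      fun x ↦ (cutoff d n x - 1) • f x := by
    funext x
    rw [sub_apply, sub_smul, one_smul]
    rfl
  rw [hfun]
  have hη : ContDiff ℝ (⊤ : ℕ∞) (fun x ↦ cutoff d n x - 1) :=
    (contDiff_cutoff d n).sub contDiff_const
  rcases lt_or_ge ‖x‖ ((n : ℝ) + 1) with hx | hx
  · have h0 : (fun x ↦ (cutoff d n x - 1) • f x) =ᶠ[𝓝 x] fun _ ↦ 0 := by
      filter_upwards [(isOpen_lt continuous_norm continuous_const).mem_nhds hx] with y hy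
      rw [cutoff_eq_one hy]
      simp
    rw [(Filter.EventuallyEq.iteratedFDeriv ℝ h0 m).eq_of_nhds]
    simp
    positivity
  · have hd : ∀ i, ‖iteratedFDeriv ℝ i (fun x ↦ cutoff d n x - 1) x‖ ≤ c i + 1 := by
      intro i
      have : (fun x ↦ cutoff d n x - 1) = cutoff d n - fun _ ↦ (1 : ℝ) := rfl
      rw [this, iteratedFDeriv_sub_apply
        (((contDiff_cutoff d n).of_le (by exact_mod_cast le_top)).contDiffAt)
        contDiff_const.contDiffAt]
      refine (norm_sub_le _ _).trans (add_le_add (hc i n x) ?_)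
      rcases Nat.eq_zero_or_pos i with rfl | hi
      · simp
      · rw [iteratedFDeriv_const_of_ne hi.ne']
        simp
    calc ‖x‖ ^ k * ‖iteratedFDeriv ℝ m (fun x ↦ (cutoff d n x - 1) • f x) x‖
        ≤ ‖x‖ ^ k * ∑ i ∈ Finset.range (m + 1), (m.choose i : ℝ) *
            ‖iteratedFDeriv ℝ i (fun x ↦ cutoff d n x - 1) x‖ * ‖iteratedFDeriv ℝ (m - i) f x‖ := by
          gcongr
          exact norm_iteratedFDeriv_smul_le hη (f.smooth ⊤) x (by exact_mod_cast le_top)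
      _ ≤ A / (n + 1) := by
          rw [le_div_iff₀ (by positivity), mul_right_comm, Finset.mul_sum]
          refine Finset.sum_le_sum fun i _ ↦ ?_
          have h3 := SchwartzMap.le_seminorm ℝ (k + 1) (m - i) f x
          have h4 : ‖x‖ ^ k * ((n : ℝ) + 1) ≤ ‖x‖ ^ (k + 1) := by
            rw [pow_succ]
            gcongr
          calc ‖x‖ ^ k * ((n : ℝ) + 1) * ((m.choose i : ℝ) *
                ‖iteratedFDeriv ℝ i (fun x ↦ cutoff d n x - 1) x‖ * ‖iteratedFDeriv ℝ (m - i) f x‖)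
              ≤ ‖x‖ ^ (k + 1) * ((m.choose i : ℝ) * (c i + 1) * ‖iteratedFDeriv ℝ (m - i) f x‖) := by
                gcongr
                exact hd i
            _ = (m.choose i : ℝ) * (c i + 1) * (‖x‖ ^ (k + 1) * ‖iteratedFDeriv ℝ (m - i) f x‖) := by
                ring
            _ ≤ _ := by
                have := hc0 i
                gcongr

theorem tendsto_truncate {d : ℕ} (f : 𝓢(RVec d, ℂ)) :
    Tendsto (fun n ↦ truncate n f) atTop (𝓝 f) := by
  rw [(schwartz_withSeminorms ℝ (RVec d) ℂ).tendsto_nhds]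
  rintro ⟨k, m⟩ ε hε
  obtain ⟨C, hC⟩ := seminorm_truncate_sub_le f k m
  have h : Tendsto (fun n : ℕ ↦ C / ((n : ℝ) + 1)) atTop (𝓝 0) :=
    tendsto_const_nhds.div_atTop (tendsto_natCast_atTop_atTop.atTop_add tendsto_const_nhds)
  filter_upwards [h.eventually (gt_mem_nhds hε)] with n hn
  exact (hC n).trans_lt hn

/-- The test field whose `i`-th coordinate is `a`, and whose other coordinates vanish. -/
def TestField.single {d : ℕ} (i : Fin d) (a : RVec d → ℝ) (ha : ContDiff ℝ (⊤ : ℕ∞) a)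
    (hc : HasCompactSupport a) : TestField d where
  toFun x := EuclideanSpace.single i (a x)
  smooth := by
    rw [contDiff_euclidean]
    intro j
    by_cases h : j = i
    · subst h
      simpa using ha
    · simpa [h] using contDiff_const
  compactSupport := hc.comp_left (g := fun r ↦ EuclideanSpace.single i r) (by simp)

/-- `evalTest` sees only real parts; reality of `u` supplies the imaginary ones. So `u` kills the
real and imaginary parts of every truncated Schwartz function, and truncations converge in the
Schwartz topology. -/
theorem eq_zero_of_evalTest_eq_zero {d : ℕ} {u : 𝓢'(RVec d, CVec d)} (hu : IsRealField u)
    (h : ∀ φ, evalTest u φ = 0) : u = 0 := by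
  have hreal : ∀ (i : Fin d) (a : RVec d → ℝ) (ha : ContDiff ℝ (⊤ : ℕ∞) a)
      (hc : HasCompactSupport a), u ((TestField.single i a ha hc).component i) i = 0 := by
    intro i a ha hc
    apply Complex.ext
    · have h1 := h (TestField.single i a ha hc)
      rw [evalTest, Finset.sum_eq_single i] at h1
      · exact h1
      · intro j _ hj
        have : (TestField.single i a ha hc).component j = 0 := by
          ext x
          change ((EuclideanSpace.single i (a x) j : ℝ) : ℂ) = 0
          simp [hj]
        rw [this, map_zero]
        simp
      · simp
    · exact hu _ (fun x ↦ Complex.ofReal_im _) i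
  have htr : ∀ n (g : 𝓢(RVec d, ℂ)) (i : Fin d), u (truncate n g) i = 0 := by
    intro n g i
    have hs := contDiff_cutoff d n
    have hg := g.smooth ⊤
    have h1 := hreal i (fun x ↦ cutoff d n x * (g x).re)
      (hs.mul (Complex.reCLM.contDiff.comp hg)) (hasCompactSupport_cutoff d n).mul_right
    have h2 := hreal i (fun x ↦ cutoff d n x * (g x).im)
      (hs.mul (Complex.imCLM.contDiff.comp hg)) (hasCompactSupport_cutoff d n).mul_right
    set φ₁ := TestField.single i (fun x ↦ cutoff d n x * (g x).re)
      (hs.mul (Complex.reCLM.contDiff.comp hg)) (hasCompactSupport_cutoff d n).mul_right with hφ₁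
    set φ₂ := TestField.single i (fun x ↦ cutoff d n x * (g x).im)
      (hs.mul (Complex.imCLM.contDiff.comp hg)) (hasCompactSupport_cutoff d n).mul_right with hφ₂
    have h3 : truncate n g = φ₁.component i + Complex.I • φ₂.component i := by
      ext x
      have e1 : φ₁.component i x = ((cutoff d n x * (g x).re : ℝ) : ℂ) := by
        change ((EuclideanSpace.single i (cutoff d n x * (g x).re) i : ℝ) : ℂ) = _
        simp
      have e2 : φ₂.component i x = ((cutoff d n x * (g x).im : ℝ) : ℂ) := by
        change ((EuclideanSpace.single i (cutoff d n x * (g x).im) i : ℝ) : ℂ) = _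
        simp
      rw [add_apply, smul_apply, e1, e2]
      change cutoff d n x • g x = _
      apply Complex.ext <;> simp
    rw [h3, map_add, map_smul]
    simp [h1, h2]
  ext g i
  have ht : Tendsto (fun n ↦ u (truncate n g) i) atTop (𝓝 (u g i)) :=
    (((EuclideanSpace.proj i : CVec d →L[ℂ] ℂ).continuous.comp u.continuous).tendsto g).comp
      (tendsto_truncate g)
  simp_rw [htr] at ht
  exact tendsto_nhds_unique ht tendsto_const_nhds

/-- The smooth compactly supported vector fields, as a space of functions. -/
def testSubmodule (d : ℕ) : Submodule ℝ (RVec d → RVec d) where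
  carrier := {f | ContDiff ℝ (⊤ : ℕ∞) f ∧ HasCompactSupport f}
  zero_mem' := ⟨contDiff_const, HasCompactSupport.zero⟩
  add_mem' := fun hf hg ↦ ⟨hf.1.add hg.1, hf.2.add hg.2⟩
  smul_mem' := fun _ _ hf ↦ ⟨contDiff_const.smul hf.1, hf.2.smul_left⟩

/-- The elements of `testSubmodule d` are test fields. -/
def toTestField {d : ℕ} (φ : testSubmodule d) : TestField d := ⟨φ, φ.2.1, φ.2.2⟩

/-- The map `φ ↦ (1 - Δ)^{s/2} φ` on test fields. -/
def besselTest (d : ℕ) (s : ℝ) : testSubmodule d →ₗ[ℝ] realL2 d :=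
  (sobolevEquiv d s).toLinearEquiv.toLinearMap ∘ₗ
    { toFun := fun φ ↦ (toTestField φ).toSobolev s
      map_add' := fun φ ψ ↦ by
        apply Sobolev.toDistribution_injective
        rw [map_add]
        change (((toTestField (φ + ψ)).toSchwartz : 𝓢(RVec d, CVec d)) : 𝓢'(RVec d, CVec d)) =
          ((toTestField φ).toSchwartz : 𝓢'(RVec d, CVec d)) + (toTestField ψ).toSchwartz
        rw [← map_add]
        congr 1
        refine SchwartzMap.ext fun x ↦ ?_
        exact map_add (TestField.complexify d) _ _
      map_smul' := fun c φ ↦ by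
        apply Sobolev.toDistribution_injective
        rw [map_smul, distribution_real_smul]
        change (((toTestField (c • φ)).toSchwartz : 𝓢(RVec d, CVec d)) : 𝓢'(RVec d, CVec d)) =
          (c : ℂ) • ((toTestField φ).toSchwartz : 𝓢'(RVec d, CVec d))
        rw [← map_smul]
        congr 1
        ext x i
        exact Complex.ofReal_mul c _ }

theorem besselTest_apply {d : ℕ} (s : ℝ) (φ : testSubmodule d) :
    besselTest d s φ = sobolevEquiv d s ((toTestField φ).toSobolev s) := rfl

/-- A vector orthogonal to the range is `(1 - Δ)^{-s/2} u` for some `u ∈ H_2^{-s}`, and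
orthogonality says that the distribution `u` vanishes on all test fields. -/
theorem denseRange_besselTest (d : ℕ) (s : ℝ) : DenseRange (besselTest d s) := by
  have h : (LinearMap.range (besselTest d s)).topologicalClosure = ⊤ := by
    rw [Submodule.topologicalClosure_eq_top_iff, Submodule.eq_bot_iff]
    intro f hf
    obtain ⟨u, rfl⟩ := (sobolevEquiv d (-s)).surjective f
    suffices Sobolev.toDistribution u = 0 by
      rw [Sobolev.toDistribution_injective (this.trans (map_zero _).symm), map_zero]
    refine eq_zero_of_evalTest_eq_zero u.2.1 fun φ ↦ ?_
    rw [← dualPairing_toSobolev, dualPairing_eq_inner]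
    exact Submodule.inner_left_of_mem_orthogonal
      (LinearMap.mem_range_self (besselTest d s) ⟨φ.toFun, φ.smooth, φ.compactSupport⟩) hf
  exact (Submodule.dense_iff_topologicalClosure_eq_top (s := LinearMap.range (besselTest d s))).2 h

/-! ### The Bessel kernel as a mixture of Gaussians -/

/-- The integrand in the definition of the Bessel kernel. -/
def heatWeight (d : ℕ) (α r : ℝ) (y : RVec d) : ℝ :=
  r ^ (α - (d : ℝ) / 2) * Real.exp (-‖y‖ ^ 2 / (4 * r) - r) / r

theorem besselKernel_eq {d : ℕ} (α : ℝ) (y : RVec d) :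
    besselKernel d α y = (Real.Gamma α * (4 * Real.pi) ^ ((d : ℝ) / 2))⁻¹ *
      ∫ r in Set.Ioi (0 : ℝ), heatWeight d α r y := rfl

theorem heatWeight_nonneg {d : ℕ} (α : ℝ) {r : ℝ} (hr : 0 < r) (y : RVec d) :
    0 ≤ heatWeight d α r y := by
  unfold heatWeight
  positivity

theorem besselKernel_nonneg {d : ℕ} {α : ℝ} (hα : 0 < α) (y : RVec d) : 0 ≤ besselKernel d α y := by
  rw [besselKernel_eq]
  have := Real.Gamma_pos_of_pos hα
  have h : 0 ≤ ∫ r in Set.Ioi (0 : ℝ), heatWeight d α r y :=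
    setIntegral_nonneg measurableSet_Ioi fun r hr ↦ heatWeight_nonneg α hr y
  positivity

theorem measurable_heatWeight (d : ℕ) (α : ℝ) :
    Measurable fun p : ℝ × RVec d ↦ heatWeight d α p.1 p.2 := by
  unfold heatWeight
  fun_prop

theorem measurable_besselKernel (d : ℕ) (α : ℝ) : Measurable (besselKernel d α) := by
  have h : StronglyMeasurable fun y : RVec d ↦ ∫ r in Set.Ioi (0 : ℝ), heatWeight d α r y :=
    ((measurable_heatWeight d α).comp measurable_swap).stronglyMeasurable.integral_prod_right'
  exact h.measurable.const_mul _

theorem measurable_besselKernelHat (d : ℕ) (α : ℝ) : Measurable (besselKernelHat d α) := by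
  unfold besselKernelHat
  exact Measurable.ite (measurableSet_singleton 0) measurable_const
    (measurable_besselKernel d α).ennreal_ofReal

/-- Near `r = 0` the factor `e^{-c/r}` beats every negative power: `e^{-c/r} ≤ N! (r/c)^N`. Taking
`N > d/2 - α` leaves a convergent Gamma integrand. -/
theorem integrableOn_heatWeight {d : ℕ} (α : ℝ) {y : RVec d} (hy : y ≠ 0) :
    IntegrableOn (fun r ↦ heatWeight d α r y) (Set.Ioi 0) := by
  set c : ℝ := ‖y‖ ^ 2 / 4 with hc
  have hc0 : 0 < c := by positivity
  obtain ⟨N, hN⟩ := exists_nat_gt ((d : ℝ) / 2 - α)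
  have hG := (Real.GammaIntegral_convergent (s := α - (d : ℝ) / 2 + N) (by linarith)).const_mul
    ((N.factorial : ℝ) / c ^ N)
  refine Integrable.mono' hG ((measurable_heatWeight d α).comp
    measurable_prodMk_right).aestronglyMeasurable ?_
  filter_upwards [ae_restrict_mem measurableSet_Ioi] with r hr
  rw [Set.mem_Ioi] at hr
  rw [Real.norm_of_nonneg (heatWeight_nonneg α hr y), heatWeight]
  have h1 : Real.exp (-‖y‖ ^ 2 / (4 * r) - r) = (Real.exp (c / r))⁻¹ * Real.exp (-r) := by
    rw [← Real.exp_neg, ← Real.exp_add, hc]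
    congr 1
    field_simp
    ring
  have h2 : (c / r) ^ N / N.factorial ≤ Real.exp (c / r) :=
    Real.pow_div_factorial_le_exp _ (by positivity) N
  have h3 : (Real.exp (c / r))⁻¹ ≤ N.factorial / c ^ N * r ^ N := by
    refine (inv_anti₀ (by positivity) h2).trans_eq ?_
    rw [div_pow]
    field_simp
  have h4 : r ^ (α - (d : ℝ) / 2 + N - 1) = r ^ (α - (d : ℝ) / 2) * r ^ N / r := by
    rw [Real.rpow_sub hr, Real.rpow_add hr, Real.rpow_natCast, Real.rpow_one]
  rw [h1, h4]
  calc r ^ (α - (d : ℝ) / 2) * ((Real.exp (c / r))⁻¹ * Real.exp (-r)) / r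
      ≤ r ^ (α - (d : ℝ) / 2) * ((N.factorial / c ^ N * r ^ N) * Real.exp (-r)) / r := by
        gcongr
    _ = _ := by ring

/-- The symbol of `(1 - Δ)^{-α}` as a mixture of Gaussians. -/
theorem ofReal_besselSymbol_eq_lintegral {d : ℕ} {α : ℝ} (hα : 0 < α) (l : RVec d) :
    ENNReal.ofReal (besselSymbol d (-(2 * α)) l) = ENNReal.ofReal (Real.Gamma α)⁻¹ *
      ∫⁻ r in Set.Ioi (0 : ℝ), ENNReal.ofReal (r ^ (α - 1) * Real.exp (-r)) *
        ENNReal.ofReal (Real.exp (-(r * ‖(2 * Real.pi) • l‖ ^ 2))) := by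
  set B : ℝ := 1 + ‖(2 * Real.pi) • l‖ ^ 2 with hB
  have hB0 : 0 < B := by positivity
  have hG := Real.Gamma_pos_of_pos hα
  have h1 := Real.integral_rpow_mul_exp_neg_mul_Ioi hα hB0
  -- The integral of a non-integrable function is `0` by convention, while the value in `h1` is
  -- positive.
  have hint : IntegrableOn (fun r : ℝ ↦ r ^ (α - 1) * Real.exp (-(B * r))) (Set.Ioi 0) := by
    by_contra h
    rw [integral_undef h] at h1
    have : 0 < (1 / B) ^ α * Real.Gamma α := by positivity
    exact this.ne h1
  have h2 : ∀ r ∈ Set.Ioi (0 : ℝ), ENNReal.ofReal (r ^ (α - 1) * Real.exp (-r)) *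
        ENNReal.ofReal (Real.exp (-(r * ‖(2 * Real.pi) • l‖ ^ 2))) =
        ENNReal.ofReal (r ^ (α - 1) * Real.exp (-(B * r))) := by
    intro r hr
    rw [Set.mem_Ioi] at hr
    rw [← ENNReal.ofReal_mul (by positivity), mul_assoc, ← Real.exp_add]
    congr 3
    rw [hB]
    ring
  rw [setLIntegral_congr_fun measurableSet_Ioi h2, ← ofReal_integral_eq_lintegral_ofReal hint
    ((ae_restrict_mem measurableSet_Ioi).mono fun r hr ↦ by
      rw [Set.mem_Ioi] at hr
      simp only [Pi.zero_apply]
      positivity), h1, ← ENNReal.ofReal_mul (by positivity)]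
  congr 1
  rw [besselSymbol, ← hB, one_div, Real.inv_rpow hB0.le, ← Real.rpow_neg hB0.le]
  field_simp

theorem integrable_gaussian (d : ℕ) {r : ℝ} (hr : 0 < r) :
    Integrable fun l : RVec d ↦ Real.exp (-(r * ‖(2 * Real.pi) • l‖ ^ 2)) := by
  have h := GaussianFourier.integrable_cexp_neg_mul_sq_norm_add (V := RVec d)
    (b := ((4 * Real.pi ^ 2 * r : ℝ) : ℂ)) (by rw [Complex.ofReal_re]; positivity) 0 0
  refine h.norm.congr (Eventually.of_forall fun l ↦ ?_)
  simp only [Complex.norm_exp]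
  congr 1
  simp [← Complex.ofReal_pow, norm_smul, abs_of_pos Real.pi_pos]
  norm_cast
  ring

/-- The Fourier transform of a Gaussian. -/
theorem integral_gaussian_fourierChar {d : ℕ} {r : ℝ} (hr : 0 < r) (y : RVec d) :
    ∫ l : RVec d, (Real.fourierChar (inner ℝ y l) : ℂ) *
        (Real.exp (-(r * ‖(2 * Real.pi) • l‖ ^ 2)) : ℂ) =
      (((4 * Real.pi * r) ^ (-((d : ℝ) / 2)) * Real.exp (-‖y‖ ^ 2 / (4 * r)) : ℝ) : ℂ) := by
  -- Evaluation at `-y` cancels the sign in the Fourier kernel; `b = 4π² r` absorbs the factor `2π`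
  -- in the norm.
  have h := fourier_gaussian_innerProductSpace (V := RVec d)
    (b := ((4 * Real.pi ^ 2 * r : ℝ) : ℂ)) (by rw [Complex.ofReal_re]; positivity) (-y)
  rw [Real.fourier_eq] at h
  convert h using 1
  · congr 1
    funext l
    rw [Circle.smul_def, smul_eq_mul]
    congr 2
    · simp only [inner_neg_right, neg_neg, real_inner_comm]
      rfl
    · push_cast
      congr 1
      rw [norm_smul]
      simp [abs_of_pos Real.pi_pos]
      ring
  · have hp := Real.pi_pos
    have h1 : (Real.pi : ℂ) / ((4 * Real.pi ^ 2 * r : ℝ) : ℂ) =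
        (((4 * Real.pi * r)⁻¹ : ℝ) : ℂ) := by
      push_cast
      field_simp
    rw [h1, Complex.ofReal_mul, Real.rpow_neg (by positivity), ← Real.inv_rpow (by positivity),
      Complex.ofReal_cpow (by positivity)]
    congr 1
    · simp
    · push_cast
      congr 1
      rw [norm_neg]
      have : (Real.pi : ℂ) ≠ 0 := by exact_mod_cast hp.ne'
      field_simp

/-! ### The Bessel energy of the current carried by a path -/

section Path

variable {S : Type*}

theorem norm_complexify {d : ℕ} (v : RVec d) : ‖TestField.complexify d v‖ = ‖v‖ := by
  simp [EuclideanSpace.norm_eq]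

theorem inner_complexify {d : ℕ} (v w : RVec d) :
    inner ℂ (TestField.complexify d v) (TestField.complexify d w) = ((inner ℝ v w : ℝ) : ℂ) := by
  simp [PiLp.inner_apply]

/-- The integrand of the Fourier transform of the current `φ ↦ ∫ ⟨φ(x s), v s⟩ ds`. -/
def pathWave {d : ℕ} (x v : S → RVec d) (l : RVec d) (s : S) : CVec d :=
  (Real.fourierChar (-(inner ℝ (x s) l)) : ℂ) • TestField.complexify d (v s)

theorem norm_pathWave {d : ℕ} (x v : S → RVec d) (l : RVec d) (s : S) :
    ‖pathWave x v l s‖ = ‖v s‖ := by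
  rw [pathWave, norm_smul, norm_complexify, Circle.norm_coe, one_mul]

/-- The two characters merge into one of `x t - x s`, the argument at which the kernel will appear.
-/
theorem inner_pathWave {d : ℕ} (x v : S → RVec d) (l : RVec d) (s t : S) :
    inner ℂ (pathWave x v l t) (pathWave x v l s) =
      (Real.fourierChar (inner ℝ (x t - x s) l) : ℂ) * ((inner ℝ (v t) (v s) : ℝ) : ℂ) := by
  rw [pathWave, pathWave, inner_smul_left, inner_smul_right, inner_complexify, ← mul_assoc]
  congr 1
  rw [inner_sub_left, sub_eq_add_neg, AddChar.map_add_eq_mul, ← Circle.coe_inv_eq_conj,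
    AddChar.map_neg_eq_inv, inv_inv, Circle.coe_mul]

variable [MeasurableSpace S]

theorem measurable_pathWave {d : ℕ} {x v : S → RVec d} (hx : Measurable x) (hv : Measurable v) :
    Measurable fun p : RVec d × S ↦ pathWave x v p.1 p.2 := by
  unfold pathWave
  have h1 : Measurable fun p : RVec d × S ↦ (Real.fourierChar (-(inner ℝ (x p.2) p.1)) : ℂ) := by
    have h : Continuous fun r : ℝ ↦ (Real.fourierChar r : ℂ) :=
      continuous_subtype_val.comp Real.continuous_fourierChar
    exact h.measurable.comp (((hx.comp measurable_snd).inner measurable_fst).neg)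
  exact h1.smul ((TestField.complexify d).continuous.measurable.comp (hv.comp measurable_snd))

theorem measurable_pathWave_right {d : ℕ} {x v : S → RVec d} (hx : Measurable x)
    (hv : Measurable v) (l : RVec d) : Measurable (pathWave x v l) := by
  have h := (measurable_pathWave hx hv).comp (measurable_prodMk_left (x := l))
  exact h

variable {ν : Measure S}

theorem integrable_pathWave [IsFiniteMeasure ν] {d : ℕ} {x v : S → RVec d}
    (hx : Measurable x) (hv : Measurable v)
    {M : ℝ} (hM : ∀ᵐ s ∂ν, ‖v s‖ ≤ M) (l : RVec d) : Integrable (pathWave x v l) ν :=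
  Integrable.of_bound (measurable_pathWave_right hx hv l).aestronglyMeasurable M
    (by simpa [norm_pathWave] using hM)

/-- The Fourier transform of the current `φ ↦ ∫ ⟨φ(x s), v s⟩ ds`. -/
def pathFourier {d : ℕ} (ν : Measure S) (x v : S → RVec d) (l : RVec d) : CVec d :=
  ∫ s, pathWave x v l s ∂ν

theorem measurable_pathFourier [SFinite ν] {d : ℕ} {x v : S → RVec d}
    (hx : Measurable x)
    (hv : Measurable v) : Measurable (pathFourier ν x v) :=
  (measurable_pathWave hx hv).stronglyMeasurable.integral_prod_right'.measurable

theorem norm_pathFourier_le [IsFiniteMeasure ν] {d : ℕ} {x v : S → RVec d} {M : ℝ}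
    (hM : ∀ᵐ s ∂ν, ‖v s‖ ≤ M)
    (l : RVec d) : ‖pathFourier ν x v l‖ ≤ M * ν.real Set.univ :=
  norm_integral_le_of_norm_le_const (by simpa [norm_pathWave] using hM)

theorem ae_prod_norm_inner_le [SFinite ν] {d : ℕ} {v : S → RVec d} {M : ℝ}
    (hM : ∀ᵐ s ∂ν, ‖v s‖ ≤ M) :
    ∀ᵐ p ∂ν.prod ν, |inner ℝ (v p.2) (v p.1)| ≤ M * M := by
  filter_upwards [Measure.quasiMeasurePreserving_fst.ae hM,
    Measure.quasiMeasurePreserving_snd.ae hM] with p h1 h2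
  exact (abs_real_inner_le_norm _ _).trans (mul_le_mul h2 h1 (norm_nonneg _)
    ((norm_nonneg _).trans h1))

theorem norm_sq_pathFourier [IsFiniteMeasure ν] {d : ℕ} {x v : S → RVec d}
    (hx : Measurable x) (hv : Measurable v)
    {M : ℝ} (hM : ∀ᵐ s ∂ν, ‖v s‖ ≤ M) (l : RVec d) :
    ((‖pathFourier ν x v l‖ ^ 2 : ℝ) : ℂ) =
      ∫ p, (Real.fourierChar (inner ℝ (x p.2 - x p.1) l) : ℂ) *
        ((inner ℝ (v p.2) (v p.1) : ℝ) : ℂ) ∂(ν.prod ν) := by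
  have ha := integrable_pathWave hx hv hM l
  have hm := measurable_pathWave_right hx hv l
  have hp : Integrable (fun p : S × S ↦ inner ℂ (pathWave x v l p.2) (pathWave x v l p.1))
      (ν.prod ν) := by
    have h2 : Measurable fun p : S × S ↦ pathWave x v l p.2 := hm.comp measurable_snd
    have h1 : Measurable fun p : S × S ↦ pathWave x v l p.1 := hm.comp measurable_fst
    have h3 : Measurable fun p : S × S ↦ inner ℂ (pathWave x v l p.2) (pathWave x v l p.1) :=
      h2.inner h1
    refine Integrable.of_bound h3.aestronglyMeasurable (M * M) ?_
    filter_upwards [ae_prod_norm_inner_le hM] with p hp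
    rw [inner_pathWave, norm_mul, Circle.norm_coe, one_mul, Complex.norm_real]
    exact hp
  have h1 : ∀ c : CVec d, ∫ t, inner ℂ c (pathWave x v l t) ∂ν = inner ℂ c (pathFourier ν x v l) :=
    fun c ↦ (innerSL ℂ c).integral_comp_comm ha
  have h2 : ∀ s, ∫ t, inner ℂ (pathWave x v l t) (pathWave x v l s) ∂ν =
      inner ℂ (pathFourier ν x v l) (pathWave x v l s) := by
    intro s
    rw [← inner_conj_symm, ← h1, ← integral_conj]
    simp_rw [inner_conj_symm]
  calc ((‖pathFourier ν x v l‖ ^ 2 : ℝ) : ℂ)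
      = inner ℂ (pathFourier ν x v l) (pathFourier ν x v l) := by
        rw [inner_self_eq_norm_sq_to_K]
        simp
    _ = ∫ s, ∫ t, inner ℂ (pathWave x v l t) (pathWave x v l s) ∂ν ∂ν := by
        simp_rw [h2]
        exact (h1 _).symm
    _ = ∫ p, inner ℂ (pathWave x v l p.2) (pathWave x v l p.1) ∂(ν.prod ν) :=
        (integral_prod _ hp).symm
    _ = _ := integral_congr_ae (Eventually.of_forall fun p ↦ inner_pathWave x v l p.1 p.2)

/-- The Gaussian averages of the Fourier transform of the current. -/
theorem integral_gaussian_mul_norm_sq_pathFourier [IsFiniteMeasure ν] {d : ℕ} {x v : S → RVec d}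
    (hx : Measurable x)
    (hv : Measurable v) {M : ℝ} (hM : ∀ᵐ s ∂ν, ‖v s‖ ≤ M) {r : ℝ} (hr : 0 < r) :
    ∫ l, Real.exp (-(r * ‖(2 * Real.pi) • l‖ ^ 2)) * ‖pathFourier ν x v l‖ ^ 2 =
      ∫ p, (4 * Real.pi * r) ^ (-((d : ℝ) / 2)) * Real.exp (-‖x p.2 - x p.1‖ ^ 2 / (4 * r)) *
        inner ℝ (v p.2) (v p.1) ∂(ν.prod ν) := by
  have hmF : Measurable fun q : RVec d × (S × S) ↦
      ((Real.fourierChar (inner ℝ (x q.2.2 - x q.2.1) q.1) : ℂ) *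
      (Real.exp (-(r * ‖(2 * Real.pi) • q.1‖ ^ 2)) : ℂ)) *
        ((inner ℝ (v q.2.2) (v q.2.1) : ℝ) : ℂ) := by
    have h : Continuous fun r : ℝ ↦ (Real.fourierChar r : ℂ) :=
      continuous_subtype_val.comp Real.continuous_fourierChar
    have h1 : Measurable fun q : RVec d × (S × S) ↦ inner ℝ (x q.2.2 - x q.2.1) q.1 :=
      ((hx.comp (measurable_snd.comp measurable_snd)).sub
        (hx.comp (measurable_fst.comp measurable_snd))).inner measurable_fst
    have h2 : Measurable fun q : RVec d × (S × S) ↦ inner ℝ (v q.2.2) (v q.2.1) :=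
      (hv.comp (measurable_snd.comp measurable_snd)).inner
        (hv.comp (measurable_fst.comp measurable_snd))
    have h3 : Measurable fun q : RVec d × (S × S) ↦
      Real.exp (-(r * ‖(2 * Real.pi) • q.1‖ ^ 2)) := by fun_prop
    exact ((h.measurable.comp h1).mul (Complex.measurable_ofReal.comp h3)).mul
      (Complex.measurable_ofReal.comp h2)
  have hF : Integrable (fun q : RVec d × (S × S) ↦
      ((Real.fourierChar (inner ℝ (x q.2.2 - x q.2.1) q.1) : ℂ) *
      (Real.exp (-(r * ‖(2 * Real.pi) • q.1‖ ^ 2)) : ℂ)) *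
        ((inner ℝ (v q.2.2) (v q.2.1) : ℝ) : ℂ)) (volume.prod (ν.prod ν)) := by
    have h1 := (integrable_gaussian d hr).mul_prod (integrable_const (M * M) (μ := ν.prod ν))
    refine h1.mono' hmF.aestronglyMeasurable ?_
    filter_upwards [Measure.quasiMeasurePreserving_snd.ae (ae_prod_norm_inner_le hM)] with q hq
    rw [norm_mul, norm_mul, Circle.norm_coe, one_mul, Complex.norm_real, Complex.norm_real,
      Real.norm_of_nonneg (Real.exp_nonneg _)]
    gcongr
    exact hq
  have h := integral_integral_swap (f := fun (l : RVec d) (p : S × S) ↦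
      ((Real.fourierChar (inner ℝ (x p.2 - x p.1) l) : ℂ) *
      (Real.exp (-(r * ‖(2 * Real.pi) • l‖ ^ 2)) : ℂ)) *
        ((inner ℝ (v p.2) (v p.1) : ℝ) : ℂ)) hF
  apply Complex.ofReal_injective
  rw [← integral_complex_ofReal, ← integral_complex_ofReal]
  convert h using 1
  · congr 1
    funext l
    rw [Complex.ofReal_mul, norm_sq_pathFourier hx hv hM, ← integral_const_mul]
    congr 1
    funext p
    ring
  · congr 1
    funext p
    rw [integral_mul_const, integral_gaussian_fourierChar hr, Complex.ofReal_mul]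

end Path

/-! ### The energy as a weighted integral on the Fourier side -/

section Path

variable {S : Type*} [MeasurableSpace S] {ν : Measure S} [IsFiniteMeasure ν]

/-- The energy density `K_α(x_t - x_s) ⟨v_t, v_s⟩`. -/
def energyDensity {d : ℕ} (α : ℝ) (x v : S → RVec d) (p : S × S) : ℝ :=
  besselKernel d α (x p.2 - x p.1) * inner ℝ (v p.2) (v p.1)

/-- The value `∞` of `besselKernelHat` at the origin forces the pairs with `x t = x s` to be null.
There `besselKernel` may have only the default value `0` of a divergent integral (when `α ≤ d/2`),
which is thus harmless. -/
theorem ae_ne_and_integrable_besselKernel {d : ℕ} {α : ℝ} (hα : 0 < α) {x : S → RVec d}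
    (hx : Measurable x) (hB : ∫⁻ s, ∫⁻ t, besselKernelHat d α (x t - x s) ∂ν ∂ν < ∞) :
    (∀ᵐ p ∂ν.prod ν, x p.2 - x p.1 ≠ 0) ∧
      Integrable (fun p : S × S ↦ besselKernel d α (x p.2 - x p.1)) (ν.prod ν) := by
  have hd : Measurable fun p : S × S ↦ x p.2 - x p.1 :=
    (hx.comp measurable_snd).sub (hx.comp measurable_fst)
  have hm : Measurable fun p : S × S ↦ besselKernelHat d α (x p.2 - x p.1) :=
    (measurable_besselKernelHat d α).comp hd
  rw [← lintegral_prod _ hm.aemeasurable] at hB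
  have hne : ∀ᵐ p ∂ν.prod ν, x p.2 - x p.1 ≠ 0 := by
    filter_upwards [ae_lt_top hm hB.ne] with p hp h0
    simp [besselKernelHat, h0] at hp
  refine ⟨hne, ((measurable_besselKernel d α).comp hd).aestronglyMeasurable, ?_⟩
  rw [hasFiniteIntegral_iff_ofReal (Eventually.of_forall fun p ↦ besselKernel_nonneg hα _)]
  refine (lintegral_mono_ae ?_).trans_lt hB
  filter_upwards [hne] with p hp
  rw [besselKernelHat, if_neg hp]

theorem integrable_energyDensity {d : ℕ} {α : ℝ} (hα : 0 < α) {x v : S → RVec d}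
    (hx : Measurable x) (hv : Measurable v) {M : ℝ} (hM : ∀ᵐ s ∂ν, ‖v s‖ ≤ M)
    (hB : ∫⁻ s, ∫⁻ t, besselKernelHat d α (x t - x s) ∂ν ∂ν < ∞) :
    Integrable (energyDensity α x v) (ν.prod ν) := by
  refine (ae_ne_and_integrable_besselKernel hα hx hB).2.mul_bdd (c := M * M) ?_ ?_
  · have h : Measurable fun p : S × S ↦ inner ℝ (v p.2) (v p.1) :=
      (hv.comp measurable_snd).inner (hv.comp measurable_fst)
    exact h.aestronglyMeasurable
  · exact ae_prod_norm_inner_le hM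

/-- Tonelli: off the null diagonal the `r`-integral of the weight is a multiple of `K_α`, integrable
by the kernel hypothesis, and the inner product is bounded. This allows the Gaussian scale `r` and
the double time integral to be exchanged. -/
theorem integrable_heatWeight_mul_inner {d : ℕ} {α : ℝ} (hα : 0 < α) {x v : S → RVec d}
    (hx : Measurable x) (hv : Measurable v) {M : ℝ} (hM : ∀ᵐ s ∂ν, ‖v s‖ ≤ M)
    (hB : ∫⁻ s, ∫⁻ t, besselKernelHat d α (x t - x s) ∂ν ∂ν < ∞) :
    Integrable (fun q : ℝ × (S × S) ↦
      heatWeight d α q.1 (x q.2.2 - x q.2.1) * inner ℝ (v q.2.2) (v q.2.1))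
      ((volume.restrict (Set.Ioi 0)).prod (ν.prod ν)) := by
  obtain ⟨hne, hK⟩ := ae_ne_and_integrable_besselKernel hα hx hB
  have hd : Measurable fun p : S × S ↦ x p.2 - x p.1 :=
    (hx.comp measurable_snd).sub (hx.comp measurable_fst)
  have hm : Measurable fun q : ℝ × (S × S) ↦ heatWeight d α q.1 (x q.2.2 - x q.2.1) := by
    have h := (measurable_heatWeight d α).comp (measurable_fst.prodMk (hd.comp measurable_snd))
    exact h
  have hi : Measurable fun p : S × S ↦ inner ℝ (v p.2) (v p.1) :=
    (hv.comp measurable_snd).inner (hv.comp measurable_fst)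
  have hW : Integrable (fun q : ℝ × (S × S) ↦ heatWeight d α q.1 (x q.2.2 - x q.2.1))
      ((volume.restrict (Set.Ioi 0)).prod (ν.prod ν)) := by
    rw [integrable_prod_iff' hm.aestronglyMeasurable]
    refine ⟨?_, ?_⟩
    · filter_upwards [hne] with p hp
      have h := integrableOn_heatWeight α hp
      exact h
    refine (hK.const_mul (Real.Gamma α * (4 * Real.pi) ^ ((d : ℝ) / 2))).congr
      (Eventually.of_forall fun p ↦ ?_)
    have hG := Real.Gamma_pos_of_pos hα
    change Real.Gamma α * (4 * Real.pi) ^ ((d : ℝ) / 2) * besselKernel d α (x p.2 - x p.1) =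
      ∫ r in Set.Ioi (0 : ℝ), ‖heatWeight d α r (x p.2 - x p.1)‖
    rw [besselKernel_eq, mul_inv_cancel_left₀ (by positivity)]
    refine setIntegral_congr_fun measurableSet_Ioi fun r hr ↦ ?_
    exact (Real.norm_of_nonneg (heatWeight_nonneg α hr _)).symm
  refine hW.mul_bdd (c := M * M) ?_ ?_
  · exact (hi.comp measurable_snd).aestronglyMeasurable
  · exact Measure.quasiMeasurePreserving_snd.ae (ae_prod_norm_inner_le hM)

/-- The square of the norm in `H_2^{-α}` of the current `φ ↦ ∫ ⟨φ(x s), v s⟩ ds` is its energy. -/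
theorem lintegral_symbol_mul_norm_sq_pathFourier {d : ℕ} {α : ℝ} (hα : 0 < α) {x v : S → RVec d}
    (hx : Measurable x) (hv : Measurable v) {M : ℝ} (hM : ∀ᵐ s ∂ν, ‖v s‖ ≤ M)
    (hB : ∫⁻ s, ∫⁻ t, besselKernelHat d α (x t - x s) ∂ν ∂ν < ∞) :
    ∫⁻ l, ENNReal.ofReal (besselSymbol d (-(2 * α)) l) *
        ENNReal.ofReal (‖pathFourier ν x v l‖ ^ 2) =
      ENNReal.ofReal (∫ p, energyDensity α x v p ∂(ν.prod ν)) ∧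
    0 ≤ ∫ p, energyDensity α x v p ∂(ν.prod ν) := by
  have hG := Real.Gamma_pos_of_pos hα
  have hF := measurable_pathFourier (ν := ν) hx hv
  have hF2 : Measurable fun l ↦ ENNReal.ofReal (‖pathFourier ν x v l‖ ^ 2) :=
    (hF.norm.pow_const 2).ennreal_ofReal
  have hm1 : Measurable fun p : RVec d × ℝ ↦ ENNReal.ofReal (p.2 ^ (α - 1) * Real.exp (-p.2)) *
      ENNReal.ofReal (Real.exp (-(p.2 * ‖(2 * Real.pi) • p.1‖ ^ 2))) := by fun_prop
  -- The share of scale `r` in the energy, normalized so that its integral over `r` is `Γ(α)` times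
  -- the energy.
  set H : ℝ → ℝ := fun r ↦ (4 * Real.pi) ^ (-((d : ℝ) / 2)) *
    ∫ p, heatWeight d α r (x p.2 - x p.1) * inner ℝ (v p.2) (v p.1) ∂(ν.prod ν) with hH
  have hint := integrable_heatWeight_mul_inner hα hx hv hM hB
  have hHint : Integrable H (volume.restrict (Set.Ioi 0)) :=
    hint.integral_prod_left.const_mul _
  -- The product `⟨v_t, v_s⟩` has no sign; nonnegativity of `H r` comes from its Fourier expression.
  -- It lets Tonelli be applied later, with no prior knowledge that the weighted integral over `l`
  -- is finite.
  have hgauss : ∀ r ∈ Set.Ioi (0 : ℝ), ∫⁻ l, ENNReal.ofReal (r ^ (α - 1) * Real.exp (-r)) *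
      ENNReal.ofReal (Real.exp (-(r * ‖(2 * Real.pi) • l‖ ^ 2))) *
        ENNReal.ofReal (‖pathFourier ν x v l‖ ^ 2) = ENNReal.ofReal (H r) ∧ 0 ≤ H r := by
    intro r hr
    rw [Set.mem_Ioi] at hr
    have hHr : H r = r ^ (α - 1) * Real.exp (-r) *
        ∫ l, Real.exp (-(r * ‖(2 * Real.pi) • l‖ ^ 2)) * ‖pathFourier ν x v l‖ ^ 2 := by
      rw [integral_gaussian_mul_norm_sq_pathFourier hx hv hM hr]
      simp only [hH]
      rw [← integral_const_mul, ← integral_const_mul]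
      congr 1
      funext p
      have e1 : (4 * Real.pi * r) ^ (-((d : ℝ) / 2)) =
          (4 * Real.pi) ^ (-((d : ℝ) / 2)) * r ^ (-((d : ℝ) / 2)) :=
        Real.mul_rpow (by positivity) hr.le
      have e2 : r ^ (α - (d : ℝ) / 2) / r = r ^ (α - 1) * r ^ (-((d : ℝ) / 2)) := by
        rw [← Real.rpow_add hr, div_eq_mul_inv, ← Real.rpow_neg_one, ← Real.rpow_add hr]
        congr 1
        ring
      have e3 : Real.exp (-‖x p.2 - x p.1‖ ^ 2 / (4 * r) - r) =
          Real.exp (-r) * Real.exp (-‖x p.2 - x p.1‖ ^ 2 / (4 * r)) := by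
        rw [← Real.exp_add]
        congr 1
        ring
      rw [heatWeight, mul_div_right_comm, e1, e2, e3]
      ring
    have hI : Integrable fun l ↦ Real.exp (-(r * ‖(2 * Real.pi) • l‖ ^ 2)) *
        ‖pathFourier ν x v l‖ ^ 2 := by
      refine (integrable_gaussian d hr).mul_bdd (c := (M * ν.real Set.univ) ^ 2)
        (hF.norm.pow_const 2).aestronglyMeasurable (Eventually.of_forall fun l ↦ ?_)
      rw [Real.norm_of_nonneg (by positivity)]
      exact pow_le_pow_left₀ (norm_nonneg _) (norm_pathFourier_le hM l) 2
    refine ⟨?_, ?_⟩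
    · simp_rw [mul_assoc (ENNReal.ofReal (r ^ (α - 1) * Real.exp (-r)))]
      rw [lintegral_const_mul _ (by fun_prop)]
      have e : ∀ l, ENNReal.ofReal (Real.exp (-(r * ‖(2 * Real.pi) • l‖ ^ 2))) *
          ENNReal.ofReal (‖pathFourier ν x v l‖ ^ 2) =
          ENNReal.ofReal (Real.exp (-(r * ‖(2 * Real.pi) • l‖ ^ 2)) *
            ‖pathFourier ν x v l‖ ^ 2) := fun l ↦ (ENNReal.ofReal_mul (by positivity)).symm
      simp_rw [e]
      rw [← ofReal_integral_eq_lintegral_ofReal hI (Eventually.of_forall fun l ↦ by positivity),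
        ← ENNReal.ofReal_mul (by positivity), hHr]
    · rw [hHr]
      have : 0 ≤ ∫ l, Real.exp (-(r * ‖(2 * Real.pi) • l‖ ^ 2)) * ‖pathFourier ν x v l‖ ^ 2 :=
        integral_nonneg fun l ↦ by positivity
      positivity
  have hHfin : ∫ r in Set.Ioi (0 : ℝ), H r =
      Real.Gamma α * ∫ p, energyDensity α x v p ∂(ν.prod ν) := by
    rw [hH, integral_const_mul, integral_integral_swap hint, ← integral_const_mul,
      ← integral_const_mul]
    congr 1
    funext p
    rw [energyDensity, besselKernel_eq, integral_mul_const, Real.rpow_neg (by positivity)]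
    field_simp
  have hnonneg : 0 ≤ ∫ p, energyDensity α x v p ∂(ν.prod ν) := by
    rw [← mul_nonneg_iff_of_pos_left hG, ← hHfin]
    exact setIntegral_nonneg measurableSet_Ioi fun r hr ↦ (hgauss r hr).2
  refine ⟨?_, hnonneg⟩
  calc ∫⁻ l, ENNReal.ofReal (besselSymbol d (-(2 * α)) l) *
        ENNReal.ofReal (‖pathFourier ν x v l‖ ^ 2)
      = ENNReal.ofReal (Real.Gamma α)⁻¹ * ∫⁻ l, ∫⁻ r in Set.Ioi (0 : ℝ),
          ENNReal.ofReal (r ^ (α - 1) * Real.exp (-r)) *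
          ENNReal.ofReal (Real.exp (-(r * ‖(2 * Real.pi) • l‖ ^ 2))) *
          ENNReal.ofReal (‖pathFourier ν x v l‖ ^ 2) := by
        rw [← lintegral_const_mul']
        · congr 1
          funext l
          rw [ofReal_besselSymbol_eq_lintegral hα, lintegral_mul_const, mul_assoc]
          fun_prop
        · exact ENNReal.ofReal_ne_top
    _ = ENNReal.ofReal (Real.Gamma α)⁻¹ * ∫⁻ r in Set.Ioi (0 : ℝ), ENNReal.ofReal (H r) := by
        rw [lintegral_lintegral_swap (hm1.mul (hF2.comp measurable_fst)).aemeasurable]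
        congr 1
        exact setLIntegral_congr_fun measurableSet_Ioi fun r hr ↦ (hgauss r hr).1
    _ = _ := by
        rw [← ofReal_integral_eq_lintegral_ofReal hHint
          ((ae_restrict_mem measurableSet_Ioi).mono fun r hr ↦ (hgauss r hr).2), hHfin,
          ← ENNReal.ofReal_mul (by positivity), inv_mul_cancel_left₀ hG.ne']

end Path

/-! ### Sobolev norms, Parseval's identity and the pathwise bound -/

theorem besselSymbol_mul_self {d : ℕ} (s : ℝ) (l : RVec d) :
    besselSymbol d s l * besselSymbol d s l = besselSymbol d (2 * s) l := by
  rw [besselSymbol, besselSymbol, ← Real.rpow_add (by positivity)]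
  congr 1
  ring

theorem besselSymbol_neg_mul {d : ℕ} (s : ℝ) (l : RVec d) :
    besselSymbol d (-s) l * besselSymbol d s l = 1 := by
  rw [besselSymbol, besselSymbol, ← Real.rpow_add (by positivity)]
  simp [neg_div]

/-- The norm of `H_2^s`, on the Fourier side. -/
theorem enorm_toSobolev {d : ℕ} (s : ℝ) (φ : TestField d) :
    ‖φ.toSobolev s‖ₑ =
      (∫⁻ l, (ENNReal.ofReal (besselSymbol d s l) * ‖𝓕 φ.toSchwartz l‖ₑ) ^ (2 : ℝ)) ^ (1 / 2 : ℝ) := by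
  have h1 : ‖φ.toSobolev s‖ = ‖(𝓕 (schwartzBessel d s (CVec d) φ.toSchwartz)).toLp 2‖ := by
    rw [SchwartzMap.norm_fourier_toL2_eq, Sobolev.norm_eq, besselL2_toSobolev]
  rw [← ofReal_norm, h1, ofReal_norm, Lp.enorm_def,
    eLpNorm_congr_ae (SchwartzMap.coeFn_toLp (𝓕 (schwartzBessel d s (CVec d) φ.toSchwartz)) 2
      volume), eLpNorm_eq_lintegral_rpow_enorm_toReal two_ne_zero ENNReal.ofNat_ne_top]
  simp only [ENNReal.toReal_ofNat]
  congr 1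
  refine lintegral_congr fun l ↦ ?_
  rw [schwartzBessel, SchwartzMap.fourierMultiplierCLM_apply,
    FourierTransform.fourier_fourierInv_eq, smulLeftCLM_besselSymbol_apply, enorm_smul]
  congr 2
  rw [← ofReal_norm, Complex.norm_real, Real.norm_of_nonneg (besselSymbol_pos s l).le]

theorem toSchwartz_eq_integral {d : ℕ} (φ : TestField d) (x : RVec d) :
    φ.toSchwartz x = ∫ l, (Real.fourierChar (inner ℝ l x) : ℂ) • 𝓕 φ.toSchwartz l := by
  have h : φ.toSchwartz = 𝓕⁻ (𝓕 φ.toSchwartz) := (FourierTransform.fourierInv_fourier_eq _).symm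
  nth_rewrite 1 [h]
  rw [SchwartzMap.fourierInv_coe, Real.fourierInv_eq]
  rfl

section Path

variable {S : Type*} [MeasurableSpace S] {ν : Measure S} [IsFiniteMeasure ν]

/-- Parseval's identity for the current `φ ↦ ∫ ⟨φ(x s), v s⟩ ds`. -/
theorem integral_inner_eq_integral_pathFourier {d : ℕ} {x v : S → RVec d}
    (hx : Measurable x) (hv : Measurable v) {M : ℝ} (hM : ∀ᵐ s ∂ν, ‖v s‖ ≤ M) (φ : TestField d) :
    ((∫ s, inner ℝ (φ.toFun (x s)) (v s) ∂ν : ℝ) : ℂ) =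
      ∫ l, inner ℂ (pathFourier ν x v l) (𝓕 φ.toSchwartz l) := by
  set g : 𝓢(RVec d, CVec d) := 𝓕 φ.toSchwartz with hg
  -- Fourier inversion of `φ` at the point `x s`; Fubini in `(l, s)` then finishes, with dominating
  -- function `‖g l‖ M`.
  have hpt : ∀ s, ((inner ℝ (φ.toFun (x s)) (v s) : ℝ) : ℂ) =
      ∫ l, inner ℂ (pathWave x v l s) (g l) := by
    intro s
    have hgi : Integrable fun l ↦ (Real.fourierChar (inner ℝ l (x s)) : ℂ) • g l := by
      have hc : Continuous fun l : RVec d ↦ (Real.fourierChar (inner ℝ l (x s)) : ℂ) :=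
        continuous_subtype_val.comp (Real.continuous_fourierChar.comp (by fun_prop))
      refine g.integrable.norm.mono' (hc.smul g.continuous).aestronglyMeasurable
        (Eventually.of_forall fun l ↦ ?_)
      rw [norm_smul, Circle.norm_coe, one_mul]
    have h1 : ((inner ℝ (φ.toFun (x s)) (v s) : ℝ) : ℂ) =
        inner ℂ (TestField.complexify d (v s)) (φ.toSchwartz (x s)) := by
      rw [real_inner_comm, ← inner_complexify]
      rfl
    rw [h1, toSchwartz_eq_integral]
    refine ((innerSL ℂ (TestField.complexify d (v s))).integral_comp_comm hgi).symm.trans ?_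
    congr 1
    funext l
    rw [innerSL_apply_apply, pathWave, inner_smul_left, inner_smul_right, ← Circle.coe_inv_eq_conj,
      AddChar.map_neg_eq_inv, inv_inv, real_inner_comm]
  rw [← integral_complex_ofReal]
  simp_rw [hpt]
  have hm : Measurable fun q : RVec d × S ↦ inner ℂ (pathWave x v q.1 q.2) (g q.1) :=
    (measurable_pathWave hx hv).inner (g.continuous.measurable.comp measurable_fst)
  have hF : Integrable (fun q : RVec d × S ↦ inner ℂ (pathWave x v q.1 q.2) (g q.1))
      (volume.prod ν) := by
    refine (g.integrable.norm.mul_prod (integrable_const M (μ := ν))).mono'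
      hm.aestronglyMeasurable ?_
    filter_upwards [Measure.quasiMeasurePreserving_snd.ae hM] with q hq
    refine (norm_inner_le_norm _ _).trans ?_
    rw [norm_pathWave, mul_comm]
    gcongr
  rw [← integral_integral_swap (f := fun l s ↦ inner ℂ (pathWave x v l s) (g l)) hF]
  congr 1
  funext l
  have h2 := (innerSL ℂ (g l)).integral_comp_comm (integrable_pathWave hx hv hM l)
  rw [← inner_conj_symm, pathFourier]
  change _ = conj (innerSL ℂ (g l) _)
  rw [← h2, ← integral_conj]
  congr 1
  funext s
  exact (inner_conj_symm _ _).symm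

/-- The current `φ ↦ ∫ ⟨φ(x s), v s⟩ ds` is bounded on `H_2^α`, by the square root of its energy. -/
theorem abs_integral_inner_le {d : ℕ} {α : ℝ} (hα : 0 < α) {x v : S → RVec d}
    (hx : Measurable x) (hv : Measurable v) {M : ℝ} (hM : ∀ᵐ s ∂ν, ‖v s‖ ≤ M)
    (hB : ∫⁻ s, ∫⁻ t, besselKernelHat d α (x t - x s) ∂ν ∂ν < ∞) (φ : TestField d) :
    |∫ s, inner ℝ (φ.toFun (x s)) (v s) ∂ν| ≤
      √(∫ p, energyDensity α x v p ∂(ν.prod ν)) * ‖φ.toSobolev α‖ := by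
  set I := ∫ s, inner ℝ (φ.toFun (x s)) (v s) ∂ν with hI
  set Z := ∫ p, energyDensity α x v p ∂(ν.prod ν) with hZ
  have hF := measurable_pathFourier (ν := ν) hx hv
  have hs : ∀ s : ℝ, Measurable fun l : RVec d ↦ ENNReal.ofReal (besselSymbol d s l) := fun s ↦ by
    unfold besselSymbol
    fun_prop
  have hgm : Measurable fun l ↦ ‖𝓕 φ.toSchwartz l‖ₑ :=
    (SchwartzMap.continuous (𝓕 φ.toSchwartz)).measurable.enorm
  have h1 : ‖I‖ₑ ≤ (∫⁻ l, (ENNReal.ofReal (besselSymbol d (-α) l) *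
        ‖pathFourier ν x v l‖ₑ) ^ (2 : ℝ)) ^ (1 / 2 : ℝ) * ‖φ.toSobolev α‖ₑ := by
    calc ‖I‖ₑ = ‖((I : ℝ) : ℂ)‖ₑ := by
          rw [← ofReal_norm, ← ofReal_norm, Complex.norm_real]
      _ ≤ ∫⁻ l, ‖inner ℂ (pathFourier ν x v l) (𝓕 φ.toSchwartz l)‖ₑ := by
          rw [hI, integral_inner_eq_integral_pathFourier hx hv hM φ]
          exact enorm_integral_le_lintegral_enorm _
      -- Insert the weights of orders `-α` and `α`, whose product is `1`, before Cauchy–Schwarz.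
      _ ≤ ∫⁻ l, ((fun l ↦ ENNReal.ofReal (besselSymbol d (-α) l) * ‖pathFourier ν x v l‖ₑ) *
            fun l ↦ ENNReal.ofReal (besselSymbol d α l) * ‖𝓕 φ.toSchwartz l‖ₑ) l := by
          refine lintegral_mono fun l ↦ ?_
          rw [Pi.mul_apply, mul_mul_mul_comm, ← ENNReal.ofReal_mul (besselSymbol_pos _ l).le,
            besselSymbol_neg_mul, ENNReal.ofReal_one, one_mul, ← ofReal_norm,
            ← ofReal_norm, ← ofReal_norm, ← ENNReal.ofReal_mul (norm_nonneg _)]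
          exact ENNReal.ofReal_le_ofReal (norm_inner_le_norm _ _)
      _ ≤ _ := by
          rw [enorm_toSobolev]
          exact ENNReal.lintegral_mul_le_Lp_mul_Lq _ Real.HolderConjugate.two_two
            ((hs _).mul hF.enorm).aemeasurable ((hs _).mul hgm).aemeasurable
  have h2 : ∫⁻ l, (ENNReal.ofReal (besselSymbol d (-α) l) * ‖pathFourier ν x v l‖ₑ) ^ (2 : ℝ) =
      ENNReal.ofReal Z := by
    rw [hZ, ← (lintegral_symbol_mul_norm_sq_pathFourier hα hx hv hM hB).1]
    refine lintegral_congr fun l ↦ ?_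
    rw [← ofReal_norm, ENNReal.rpow_two, mul_pow, ENNReal.ofReal_pow (norm_nonneg _),
      sq (ENNReal.ofReal (besselSymbol d (-α) l)), ← ENNReal.ofReal_mul (besselSymbol_pos _ l).le,
      besselSymbol_mul_self, mul_neg]
  have h3 : ENNReal.ofReal Z ^ (1 / 2 : ℝ) = ENNReal.ofReal √Z := by
    rcases le_total 0 Z with h | h
    · rw [Real.sqrt_eq_rpow, ENNReal.ofReal_rpow_of_nonneg h (by norm_num)]
    · rw [ENNReal.ofReal_of_nonpos h, Real.sqrt_eq_zero_of_nonpos h]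
      simp
  rw [h2, h3, ← ofReal_norm, ← ofReal_norm,
    ← ENNReal.ofReal_mul (Real.sqrt_nonneg _), ENNReal.ofReal_le_ofReal_iff (by positivity)] at h1
  exact h1

end Path

/-! ### Convergence in measure -/

section ConvergenceInMeasure

variable {Ω : Type*} [MeasurableSpace Ω] {P : Measure Ω} {κ : Type*} {l : Filter κ}

theorem tendstoInMeasure_of_norm_le_sum {E E' : Type*} [SeminormedAddCommGroup E]
    [SeminormedAddCommGroup E'] {β : Type*} (s : Finset β) {f : β → κ → Ω → E} {g : β → Ω → E}
    (h : ∀ k ∈ s, TendstoInMeasure P (f k) l (g k)) {G : κ → Ω → E'} {G' : Ω → E'} {C : ℝ}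
    (hC : 0 < C) (hG : ∀ i ω, ‖G i ω - G' ω‖ ≤ C * ∑ k ∈ s, ‖f k i ω - g k ω‖) :
    TendstoInMeasure P G l G' := by
  rw [tendstoInMeasure_iff_norm]
  intro η hη
  -- The `+ 1` covers an empty `s` and makes the final inequality strict.
  set η' : ℝ := η / (C * (s.card + 1)) with hη'
  have hη'0 : 0 < η' := by positivity
  have hsum : Tendsto (fun i ↦ ∑ k ∈ s, P {ω | η' ≤ ‖f k i ω - g k ω‖}) l (𝓝 0) := by
    rw [← Finset.sum_const_zero (s := s)]
    exact tendsto_finsetSum _ fun k hk ↦ (tendstoInMeasure_iff_norm.1 (h k hk)) η' hη'0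
  refine tendsto_of_tendsto_of_tendsto_of_le_of_le tendsto_const_nhds hsum
    (fun _ ↦ zero_le) fun i ↦ ?_
  refine (measure_mono ?_).trans (measure_biUnion_finset_le s _)
  intro ω hω
  by_contra hcon
  simp only [Set.mem_iUnion, Set.mem_ofPred_eq, not_exists, not_le] at hcon
  have h1 : ∑ k ∈ s, ‖f k i ω - g k ω‖ ≤ s.card * η' := by
    rw [← nsmul_eq_mul]
    exact Finset.sum_le_card_nsmul _ _ _ fun k hk ↦ (hcon k hk).le
  have h2 : C * (s.card * η') < η := by
    have : η = C * (s.card * η') + C * η' := by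
      rw [hη']
      field_simp
    linarith [mul_pos hC hη'0]
  have h3 := hG i ω
  rw [Set.mem_ofPred_eq] at hω
  have h4 : C * ∑ k ∈ s, ‖f k i ω - g k ω‖ ≤ C * (s.card * η') := by gcongr
  linarith

theorem measure_norm_ge_le_of_eLpNorm_le {E : Type*} [NormedAddCommGroup E] {f : Ω → E}
    (hf : AEStronglyMeasurable f P) {η r : ℝ} (hη : 0 < η)
    (h : eLpNorm f 2 P ≤ ENNReal.ofReal r) :
    P {ω | η ≤ ‖f ω‖} ≤ ENNReal.ofReal (r / η) ^ 2 := by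
  have h1 := meas_ge_le_mul_pow_eLpNorm_enorm P (p := 2) two_ne_zero ENNReal.ofNat_ne_top hf
    (ε := ENNReal.ofReal η) (by simpa using hη) (by simp)
  have h2 : {ω | η ≤ ‖f ω‖} = {ω | ENNReal.ofReal η ≤ ‖f ω‖ₑ} := by
    ext ω
    rw [Set.mem_ofPred_eq, Set.mem_ofPred_eq, ← ofReal_norm,
      ENNReal.ofReal_le_ofReal_iff (norm_nonneg _)]
  rw [h2]
  refine h1.trans ?_
  simp only [ENNReal.toReal_ofNat, ENNReal.rpow_ofNat]
  rw [← mul_pow, ENNReal.ofReal_div_of_pos hη, div_eq_mul_inv, mul_comm (ENNReal.ofReal r)]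
  gcongr

/-- Convergence in measure, by approximation in `L²`. -/
theorem tendstoInMeasure_of_approx {E : Type*} [NormedAddCommGroup E] {f : κ → Ω → E} {g : Ω → E}
    (hf : ∀ i, AEStronglyMeasurable (f i) P) (hg : AEStronglyMeasurable g P)
    (h : ∀ δ : ℝ, 0 < δ → ∃ (f' : κ → Ω → E) (g' : Ω → E), TendstoInMeasure P f' l g' ∧
      (∀ i, AEStronglyMeasurable (f' i) P) ∧ AEStronglyMeasurable g' P ∧
      (∀ᶠ i in l, eLpNorm (f i - f' i) 2 P ≤ ENNReal.ofReal δ) ∧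
      eLpNorm (g' - g) 2 P ≤ ENNReal.ofReal δ) :
    TendstoInMeasure P f l g := by
  rw [tendstoInMeasure_iff_norm]
  intro η hη
  rw [ENNReal.tendsto_nhds_zero]
  intro ε hε
  -- `δ` is fixed before the index `i`: the two approximation errors, estimated by Chebyshev, use up
  -- `ε / 2` uniformly in `i`, and convergence of the approximants supplies the other half.
  have hcont : Tendsto (fun δ : ℝ ↦ ENNReal.ofReal (δ / (η / 3)) ^ 2 +
      ENNReal.ofReal (δ / (η / 3)) ^ 2) (𝓝[>] 0) (𝓝 0) := by
    have h1 : Tendsto (fun δ : ℝ ↦ ENNReal.ofReal (δ / (η / 3)) ^ 2) (𝓝[>] 0) (𝓝 0) := by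
      have h2 : Continuous fun δ : ℝ ↦ ENNReal.ofReal (δ / (η / 3)) ^ 2 :=
        (ENNReal.continuous_pow 2).comp (ENNReal.continuous_ofReal.comp (by fun_prop))
      have h3 := (h2.tendsto 0).mono_left (nhdsWithin_le_nhds (s := Set.Ioi 0))
      simpa using h3
    simpa using h1.add h1
  have hε2 : 0 < ε / 2 := ENNReal.half_pos hε.ne'
  obtain ⟨δ, hδε, hδ⟩ := ((ENNReal.tendsto_nhds_zero.1 hcont (ε / 2) hε2).and
    self_mem_nhdsWithin).exists
  obtain ⟨f', g', hfg, hf', hg', h1, h2⟩ := h δ hδ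
  have h3 := ENNReal.tendsto_nhds_zero.1 (tendstoInMeasure_iff_norm.1 hfg (η / 3) (by positivity))
    (ε / 2) hε2
  filter_upwards [h1, h3] with i hi1 hi3
  have hsub : {ω | η ≤ ‖f i ω - g ω‖} ⊆ ({ω | η / 3 ≤ ‖(f i - f' i) ω‖} ∪
      {ω | η / 3 ≤ ‖(g' - g) ω‖}) ∪ {ω | η / 3 ≤ ‖f' i ω - g' ω‖} := by
    intro ω hω
    by_contra hcon
    simp only [Set.mem_union, Set.mem_ofPred_eq, not_or, not_le, Pi.sub_apply] at hcon hω
    have : f i ω - g ω = (f i ω - f' i ω) + (f' i ω - g' ω) + (g' ω - g ω) := by abel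
    have h4 := norm_add₃_le (a := f i ω - f' i ω) (b := f' i ω - g' ω) (c := g' ω - g ω)
    rw [← this] at h4
    linarith [hcon.1.1, hcon.1.2, hcon.2]
  calc P {ω | η ≤ ‖f i ω - g ω‖} ≤ _ := measure_mono hsub
    _ ≤ (P {ω | η / 3 ≤ ‖(f i - f' i) ω‖} + P {ω | η / 3 ≤ ‖(g' - g) ω‖}) +
        P {ω | η / 3 ≤ ‖f' i ω - g' ω‖} :=
      (measure_union_le _ _).trans (add_le_add_left (measure_union_le _ _) _)
    _ ≤ ε / 2 + ε / 2 := by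
      refine add_le_add (le_trans (add_le_add ?_ ?_) hδε) hi3
      · exact measure_norm_ge_le_of_eLpNorm_le ((hf i).sub (hf' i)) (by positivity) hi1
      · exact measure_norm_ge_le_of_eLpNorm_le (hg'.sub hg) (by positivity) h2
    _ = ε := ENNReal.add_halves ε

/-- A family that is bounded in `L²` and converges in measure converges in `L^p`, for `p < 2`. -/
theorem tendsto_eLpNorm_of_tendstoInMeasure [IsFiniteMeasure P] {E : Type*} [NormedAddCommGroup E]
    {f : κ → Ω → E} {g : Ω → E} (hfg : TendstoInMeasure P f l g)
    (hm : ∀ i, AEStronglyMeasurable (fun ω ↦ f i ω - g ω) P) {M : ℝ}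
    (hM : ∀ᶠ i in l, eLpNorm (fun ω ↦ f i ω - g ω) 2 P ≤ ENNReal.ofReal M) {p : ℝ} (hp : 0 < p)
    (hp2 : p < 2) :
    Tendsto (fun i ↦ eLpNorm (fun ω ↦ f i ω - g ω) (ENNReal.ofReal p) P) l (𝓝 0) := by
  have hp0 : ENNReal.ofReal p ≠ 0 := by simpa using hp
  have hlin : Tendsto (fun i ↦ ∫⁻ ω, ‖f i ω - g ω‖ₑ ^ p ∂P) l (𝓝 0) := by
    rw [ENNReal.tendsto_nhds_zero]
    intro ε hε
    have hε2 : 0 < ε / 2 := ENNReal.half_pos hε.ne'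
    have hη : Tendsto (fun η : ℝ ↦ ENNReal.ofReal η ^ p * P Set.univ) (𝓝[>] 0) (𝓝 0) := by
      have h1 : Tendsto (fun η : ℝ ↦ ENNReal.ofReal η ^ p) (𝓝[>] 0) (𝓝 0) := by
        have h2 : Continuous fun η : ℝ ↦ ENNReal.ofReal η ^ p :=
          ENNReal.continuous_rpow_const.comp ENNReal.continuous_ofReal
        have h3 := (h2.tendsto 0).mono_left (nhdsWithin_le_nhds (s := Set.Ioi 0))
        simpa [hp] using h3
      simpa using ENNReal.Tendsto.mul_const h1 (Or.inr (measure_ne_top P Set.univ))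
    obtain ⟨η, hηε, hη0⟩ := ((ENNReal.tendsto_nhds_zero.1 hη (ε / 2) hε2).and
      self_mem_nhdsWithin).exists
    set A : κ → Set Ω := fun i ↦ {ω | η ≤ ‖f i ω - g ω‖} with hA
    have hPA : Tendsto (fun i ↦ P (A i)) l (𝓝 0) := tendstoInMeasure_iff_norm.1 hfg η hη0
    have hexp : 0 < 1 / p - 1 / 2 := by
      rw [sub_pos]
      exact one_div_lt_one_div_of_lt hp hp2
    have hsmall : Tendsto (fun i ↦ (ENNReal.ofReal M * P (A i) ^ (1 / p - 1 / 2)) ^ p) l (𝓝 0) := by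
      have h1 : Tendsto (fun i ↦ P (A i) ^ (1 / p - 1 / 2)) l (𝓝 0) := by
        have := (ENNReal.continuous_rpow_const (y := 1 / p - 1 / 2)).tendsto 0
        rw [ENNReal.zero_rpow_of_pos hexp] at this
        exact this.comp hPA
      have h2 : Tendsto (fun i ↦ ENNReal.ofReal M * P (A i) ^ (1 / p - 1 / 2)) l (𝓝 0) := by
        simpa using ENNReal.Tendsto.const_mul h1 (Or.inr ENNReal.ofReal_ne_top)
      have := (ENNReal.continuous_rpow_const (y := p)).tendsto 0
      rw [ENNReal.zero_rpow_of_pos hp] at this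
      exact this.comp h2
    filter_upwards [hM, ENNReal.tendsto_nhds_zero.1 hsmall (ε / 2) hε2] with i hi hsi
    have hpt : ∀ ω, ‖f i ω - g ω‖ₑ ^ p ≤ ENNReal.ofReal η ^ p +
        (A i).indicator (fun ω ↦ ‖f i ω - g ω‖ₑ ^ p) ω := by
      intro ω
      by_cases hω : ω ∈ A i
      · rw [Set.indicator_of_mem hω]
        exact le_add_self
      · refine le_add_right ?_
        simp only [hA, Set.mem_ofPred_eq, not_le] at hω
        gcongr
        rw [← ofReal_norm]
        exact ENNReal.ofReal_le_ofReal hω.le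
    -- Hölder on `A i`: the `L^p` norm is at most the `L²` norm times `P(A i)^{1/p - 1/2}`, a
    -- positive power because `p < 2`. Off `A i` the integrand is below `η^p`.
    have hAi : ∫⁻ ω in A i, ‖f i ω - g ω‖ₑ ^ p ∂P ≤
        (ENNReal.ofReal M * P (A i) ^ (1 / p - 1 / 2)) ^ p := by
      have h1 := eLpNorm_le_eLpNorm_mul_rpow_measure_univ (μ := P.restrict (A i))
        (p := ENNReal.ofReal p) (q := 2) (ENNReal.ofReal_le_of_le_toReal (by simpa using hp2.le))
        ((hm i).restrict)
      rw [eLpNorm_eq_lintegral_rpow_enorm_toReal hp0 ENNReal.ofReal_ne_top,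
        ENNReal.toReal_ofReal hp.le, Measure.restrict_apply_univ, ENNReal.toReal_ofNat] at h1
      have h2 : eLpNorm (fun ω ↦ f i ω - g ω) 2 (P.restrict (A i)) ≤ ENNReal.ofReal M :=
        (eLpNorm_mono_measure _ Measure.restrict_le_self).trans hi
      have h3 := ENNReal.rpow_le_rpow (h1.trans (mul_le_mul_left h2 _)) hp.le
      rwa [← ENNReal.rpow_mul, one_div_mul_cancel hp.ne', ENNReal.rpow_one] at h3
    calc ∫⁻ ω, ‖f i ω - g ω‖ₑ ^ p ∂P
        ≤ ∫⁻ ω, (ENNReal.ofReal η ^ p + (A i).indicator (fun ω ↦ ‖f i ω - g ω‖ₑ ^ p) ω) ∂P :=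
          lintegral_mono hpt
      _ = ENNReal.ofReal η ^ p * P Set.univ +
          ∫⁻ ω, (A i).indicator (fun ω ↦ ‖f i ω - g ω‖ₑ ^ p) ω ∂P := by
          rw [lintegral_add_left measurable_const, lintegral_const]
      _ ≤ ε / 2 + ε / 2 :=
          add_le_add hηε ((lintegral_indicator_le _ _).trans (hAi.trans hsi))
      _ = ε := ENNReal.add_halves ε
  simp_rw [eLpNorm_eq_lintegral_rpow_enorm_toReal hp0 ENNReal.ofReal_ne_top,
    ENNReal.toReal_ofReal hp.le]
  have := (ENNReal.continuous_rpow_const (y := 1 / p)).tendsto 0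
  rw [ENNReal.zero_rpow_of_pos (by positivity)] at this
  exact this.comp hlin

end ConvergenceInMeasure

/-! ### Random functionals on a Hilbert space -/

section RandomFunctional

variable {Ω : Type*} [MeasurableSpace Ω] {P : Measure Ω}
  {H : Type*} [NormedAddCommGroup H] [InnerProductSpace ℝ H]
  {W : Type*} [AddCommGroup W] [Module ℝ W] {ι : W →ₗ[ℝ] H} {β : Type*}

/-- A bounded functional satisfies Bessel's inequality along vectors close to an orthonormal
system. -/
theorem sum_sq_le_of_bound {ℓ : W →ₗ[ℝ] ℝ} {Q : ℝ} (hQ : 0 ≤ Q) (hℓ : ∀ w, |ℓ w| ≤ Q * ‖ι w‖)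
    (s : Finset β) {b : β → H} (hb : Orthonormal ℝ b) (w : β → W) :
    ∑ n ∈ s, ℓ (w n) ^ 2 ≤ Q ^ 2 * (1 + √(∑ n ∈ s, ‖ι (w n) - b n‖ ^ 2)) ^ 2 := by
  set A := ∑ n ∈ s, ℓ (w n) ^ 2 with hA
  set B := √(∑ n ∈ s, ‖ι (w n) - b n‖ ^ 2) with hB
  have hA0 : 0 ≤ A := Finset.sum_nonneg fun n _ ↦ sq_nonneg _
  -- Test `ℓ` on the combination of the `w n` with its own values as coefficients. Its image is
  -- within `√A B` of `∑ ℓ(w n) b n`, of norm `√A`, whence `A ≤ Q √A (1 + B)`.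
  have h1 : ℓ (∑ n ∈ s, ℓ (w n) • w n) = A := by
    rw [map_sum]
    refine Finset.sum_congr rfl fun n _ ↦ ?_
    rw [map_smul, smul_eq_mul, sq]
  have h2 : ‖∑ n ∈ s, ℓ (w n) • b n‖ = √A := by
    rw [← Real.sqrt_sq (norm_nonneg _), ← real_inner_self_eq_norm_sq,
      hb.inner_sum (fun n ↦ ℓ (w n)) (fun n ↦ ℓ (w n)) s]
    simp [hA, sq]
  have h3 : ‖∑ n ∈ s, ℓ (w n) • (ι (w n) - b n)‖ ≤ √A * B := by
    refine (norm_sum_le _ _).trans ?_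
    simp_rw [norm_smul]
    refine (Real.sum_mul_le_sqrt_mul_sqrt _ _ _).trans_eq ?_
    simp [hA, hB]
  have h4 : A ≤ Q * (√A * (1 + B)) := by
    calc A ≤ |ℓ (∑ n ∈ s, ℓ (w n) • w n)| := by rw [h1]; exact le_abs_self A
      _ ≤ Q * ‖ι (∑ n ∈ s, ℓ (w n) • w n)‖ := hℓ _
      _ ≤ Q * (√A * (1 + B)) := by
        gcongr
        have : ι (∑ n ∈ s, ℓ (w n) • w n) =
            ∑ n ∈ s, ℓ (w n) • b n + ∑ n ∈ s, ℓ (w n) • (ι (w n) - b n) := by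
          rw [map_sum, ← Finset.sum_add_distrib]
          refine Finset.sum_congr rfl fun n _ ↦ ?_
          rw [map_smul, ← smul_add]
          congr 1
          abel
        rw [this]
        refine (norm_add_le _ _).trans ?_
        rw [h2, mul_add, mul_one]
        gcongr
  have hB0 : 0 ≤ B := Real.sqrt_nonneg _
  have h5 : √A ≤ Q * (1 + B) := by
    rcases hA0.eq_or_lt with h | h
    · rw [← h, Real.sqrt_zero]
      positivity
    · have hs : 0 < √A := Real.sqrt_pos.2 h
      have : √A * √A ≤ (Q * (1 + B)) * √A := by
        rw [Real.mul_self_sqrt hA0]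
        linarith
      exact le_of_mul_le_mul_right this hs
  calc A = √A ^ 2 := (Real.sq_sqrt hA0).symm
    _ ≤ (Q * (1 + B)) ^ 2 := by gcongr
    _ = _ := by ring

/-- Extension by continuity of a linear family of random variables. -/
theorem exists_extension (hd : DenseRange ι) {F : W → Ω → ℝ} (hF : ∀ w, MemLp (F w) 2 P)
    (hadd : ∀ w w', F (w + w') =ᵐ[P] F w + F w') (hsmul : ∀ (c : ℝ) w, F (c • w) =ᵐ[P] c • F w)
    {C : ℝ} (hC : ∀ w, ∀ h : MemLp (F w) 2 P, ‖h.toLp (F w)‖ ≤ C * ‖ι w‖) :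
    ∃ J : H →L[ℝ] Lp ℝ 2 P, (∀ w, J (ι w) =ᵐ[P] F w) ∧ ∀ h, ‖J h‖ ≤ C * ‖h‖ := by
  let f : W →ₗ[ℝ] Lp ℝ 2 P :=
    { toFun := fun w ↦ (hF w).toLp (F w)
      map_add' := fun w w' ↦ by
        rw [← MemLp.toLp_add]
        exact MemLp.toLp_congr _ _ (hadd w w')
      map_smul' := fun c w ↦ by
        rw [RingHom.id_apply, ← MemLp.toLp_const_smul]
        exact MemLp.toLp_congr _ _ (hsmul c w) }
  have hf : ∀ w, ‖f w‖ ≤ C * ‖ι w‖ := fun w ↦ hC w (hF w)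
  refine ⟨f.extendOfNorm ι, fun w ↦ ?_, fun h ↦ LinearMap.norm_extendOfNorm_apply_le hd C hf h⟩
  rw [LinearMap.extendOfNorm_eq hd ⟨C, hf⟩]
  exact (hF w).coeFn_toLp

/-- Multiplication of square integrable random variables by a unit vector. -/
def smulUnit (P : Measure Ω) {h : H} (hh : ‖h‖ = 1) : Lp ℝ 2 P →ₗᵢ[ℝ] Lp H 2 P where
  toLinearMap := ((ContinuousLinearMap.toSpanSingleton ℝ h).compLpL 2 P).toLinearMap
  norm_map' f := by
    change ‖(ContinuousLinearMap.toSpanSingleton ℝ h).compLp f‖ = ‖f‖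
    rw [Lp.norm_def, Lp.norm_def]
    congr 1
    refine eLpNorm_congr_norm_ae ?_
    filter_upwards [(ContinuousLinearMap.toSpanSingleton ℝ h).coeFn_compLp f] with ω hω
    rw [hω, ContinuousLinearMap.toSpanSingleton_apply, norm_smul, hh, mul_one]

theorem coeFn_smulUnit {h : H} (hh : ‖h‖ = 1) (f : Lp ℝ 2 P) :
    smulUnit P hh f =ᵐ[P] fun ω ↦ f ω • h :=
  (ContinuousLinearMap.toSpanSingleton ℝ h).coeFn_compLp f

/-- Sums of squares `∑ ‖f_n‖²` thereby become the squared norm of one vector `∑ f_n b_n` of `L²(Ω;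
H)`. -/
theorem orthogonalFamily_smulUnit {b : β → H} (hb : Orthonormal ℝ b) :
    OrthogonalFamily ℝ (fun _ : β ↦ Lp ℝ 2 P) fun n ↦ smulUnit P (hb.1 n) := by
  intro n m hnm f g
  rw [L2.inner_def]
  refine integral_eq_zero_of_ae ?_
  filter_upwards [coeFn_smulUnit (hb.1 n) f, coeFn_smulUnit (hb.1 m) g] with ω h1 h2
  rw [h1, h2, inner_smul_left, inner_smul_right, hb.2 hnm]
  simp

/-- Fatou's lemma for sums of squares. -/
theorem sum_norm_sq_le_of_tendstoInMeasure {κ : Type*} {l : Filter κ} [l.NeBot]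
    [l.IsCountablyGenerated] {b : β → H} (hb : Orthonormal ℝ b) (s : Finset β)
    {f : β → κ → Lp ℝ 2 P} {g : β → Lp ℝ 2 P}
    (h : ∀ n ∈ s, TendstoInMeasure P (fun i ↦ (f n i : Ω → ℝ)) l (g n)) {C : ℝ}
    (hC : ∀ᶠ i in l, ∑ n ∈ s, ‖f n i‖ ^ 2 ≤ C) : ∑ n ∈ s, ‖g n‖ ^ 2 ≤ C := by
  have hV := orthogonalFamily_smulUnit (P := P) hb
  have hC0 : 0 ≤ C := by
    obtain ⟨i, hi⟩ := hC.exists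
    exact (Finset.sum_nonneg fun n _ ↦ sq_nonneg _).trans hi
  have hco : ∀ u : β → Lp ℝ 2 P, (∑ n ∈ s, smulUnit P (hb.1 n) (u n) : Lp H 2 P) =ᵐ[P]
      fun ω ↦ ∑ n ∈ s, u n ω • b n := by
    intro u
    have h2 : ∀ᵐ ω ∂P, ∀ n ∈ s, smulUnit P (hb.1 n) (u n) ω = u n ω • b n :=
      (ae_ball_iff s.countable_toSet).2 fun n _ ↦ coeFn_smulUnit (hb.1 n) (u n)
    filter_upwards [Lp.coeFn_finsetSum s fun n ↦ smulUnit P (hb.1 n) (u n), h2] with ω h1 h2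
    rw [h1, Finset.sum_apply]
    exact Finset.sum_congr rfl h2
  have hT : TendstoInMeasure P (fun i ω ↦ ∑ n ∈ s, f n i ω • b n) l
      (fun ω ↦ ∑ n ∈ s, g n ω • b n) := by
    refine tendstoInMeasure_of_norm_le_sum s (f := fun n i ω ↦ f n i ω) (g := fun n ω ↦ g n ω) h
      one_pos fun i ω ↦ ?_
    rw [← Finset.sum_sub_distrib, one_mul]
    refine (norm_sum_le _ _).trans (Finset.sum_le_sum fun n _ ↦ ?_)
    rw [← sub_smul, norm_smul, hb.1 n, mul_one]
  -- With the sum rewritten as a single `L²` norm, lower semicontinuity under convergence in measure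
  -- applies directly.
  have hle : ∀ u : β → Lp ℝ 2 P, ∑ n ∈ s, ‖u n‖ ^ 2 ≤ C ↔
      eLpNorm (fun ω ↦ ∑ n ∈ s, u n ω • b n) 2 P ≤ ENNReal.ofReal √C := by
    intro u
    rw [← hV.norm_sum, ← eLpNorm_congr_ae (hco u), ← Lp.enorm_def, ← ofReal_norm,
      ENNReal.ofReal_le_ofReal_iff (Real.sqrt_nonneg _), Real.le_sqrt (norm_nonneg _) hC0]
  rw [hle]
  refine eLpNorm_le_of_tendstoInMeasure (hC.mono fun i hi ↦ (hle _).1 hi) hT fun i ↦ ?_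
  exact (Lp.aestronglyMeasurable _).congr (hco fun n ↦ f n i)

/-- A Hilbert-Schmidt map into square integrable random variables is given by a random vector. -/
theorem exists_random_vector [CompleteSpace H] (J : H →L[ℝ] Lp ℝ 2 P) {C : ℝ}
    (hC : ∀ (w : Set H) (b : w → H), Orthonormal ℝ b → ∀ s : Finset w,
      ∑ n ∈ s, ‖J (b n)‖ ^ 2 ≤ C) :
    ∃ ξ : Lp H 2 P, ∀ h, J h =ᵐ[P] fun ω ↦ inner ℝ (ξ ω) h := by
  obtain ⟨w, b, -⟩ := exists_hilbertBasis ℝ H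
  have hV := orthogonalFamily_smulUnit (P := P) b.orthonormal
  -- The representing vector is `∑ J(b_n) b_n`; an orthogonal series converges once its squared
  -- norms are summable.
  have hsum : Summable fun n : w ↦ smulUnit P (b.orthonormal.1 n) (J (b n)) := by
    rw [hV.summable_iff_norm_sq_summable (fun n ↦ J (b n))]
    exact summable_of_sum_le (fun n ↦ sq_nonneg _) fun s ↦ hC _ _ b.orthonormal s
  obtain ⟨ξ, hξ⟩ := hsum
  refine ⟨ξ, fun h ↦ ?_⟩
  have h1 := ((innerSL ℝ h).compLpL 2 P).hasSum hξ
  have h2 := J.hasSum (b.hasSum_repr h)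
  have h3 : ∀ n, ((innerSL ℝ h).compLpL 2 P) (smulUnit P (b.orthonormal.1 n) (J (b n))) =
      J (b.repr h n • b n) := by
    intro n
    apply Lp.ext
    rw [map_smul]
    filter_upwards [(innerSL ℝ h).coeFn_compLp (smulUnit P (b.orthonormal.1 n) (J (b n))),
      coeFn_smulUnit (b.orthonormal.1 n) (J (b n)), Lp.coeFn_smul (b.repr h n) (J (b n))]
      with ω e1 e2 e3
    refine e1.trans ?_
    rw [e2, e3, innerSL_apply_apply, inner_smul_right, Pi.smul_apply, smul_eq_mul, mul_comm,
      b.repr_apply_apply, real_inner_comm]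
  have h4 : ((innerSL ℝ h).compLpL 2 P) ξ = J h := by
    refine HasSum.unique h1 ?_
    simpa only [Function.comp_def, h3] using h2
  rw [← h4]
  filter_upwards [(innerSL ℝ h).coeFn_compLp ξ] with ω e1
  refine e1.trans ?_
  rw [innerSL_apply_apply, real_inner_comm]

end RandomFunctional

/-! ### Hilbert–Schmidt bounds from a random constant, and their limits -/

section RandomFunctional

variable {Ω : Type*} [MeasurableSpace Ω] {P : Measure Ω}
  {H : Type*} [NormedAddCommGroup H] [InnerProductSpace ℝ H]
  {W : Type*} [AddCommGroup W] [Module ℝ W] {ι : W →ₗ[ℝ] H} {β : Type*}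

theorem norm_sq_eq_integral (f : Lp ℝ 2 P) : ‖f‖ ^ 2 = ∫ ω, f ω ^ 2 ∂P := by
  rw [← real_inner_self_eq_norm_sq, L2.inner_def]
  congr 1
  funext ω
  simp [sq]

/-- Bessel's inequality passes from vectors close to an orthonormal system to the system. -/
theorem sum_norm_sq_le_of_approx (hd : DenseRange ι) {J : H →L[ℝ] Lp ℝ 2 P} {C : ℝ} {b : β → H}
    (s : Finset β) (hJ : ∀ w : β → W, ∑ n ∈ s, ‖J (ι (w n))‖ ^ 2 ≤
      C * (1 + √(∑ n ∈ s, ‖ι (w n) - b n‖ ^ 2)) ^ 2) :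
    ∑ n ∈ s, ‖J (b n)‖ ^ 2 ≤ C := by
  have h : ∀ n, ∃ u : ℕ → W, Tendsto (fun k ↦ ι (u k)) atTop (𝓝 (b n)) := by
    intro n
    obtain ⟨x, hx, hxt⟩ := mem_closure_iff_seq_limit.1 (hd (b n))
    choose u hu using hx
    exact ⟨u, by simpa only [hu] using hxt⟩
  choose u hu using h
  have h1 : Tendsto (fun k ↦ ∑ n ∈ s, ‖J (ι (u n k))‖ ^ 2) atTop (𝓝 (∑ n ∈ s, ‖J (b n)‖ ^ 2)) :=
    tendsto_finsetSum _ fun n _ ↦ (((J.continuous.tendsto _).comp (hu n)).norm).pow 2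
  have h2 : Tendsto (fun k ↦ C * (1 + √(∑ n ∈ s, ‖ι (u n k) - b n‖ ^ 2)) ^ 2) atTop
      (𝓝 (C * (1 + √(∑ n ∈ s, ‖b n - b n‖ ^ 2)) ^ 2)) := by
    refine (((Real.continuous_sqrt.tendsto _).comp (tendsto_finsetSum _ fun n _ ↦
      ((hu n).sub_const (b n)).norm.pow 2)).const_add 1 |>.pow 2).const_mul C
  simp only [sub_self, norm_zero, ne_eq, OfNat.ofNat_ne_zero, not_false_eq_true, zero_pow,
    Finset.sum_const_zero, Real.sqrt_zero, add_zero, one_pow, mul_one] at h2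
  exact le_of_tendsto_of_tendsto' h1 h2 fun k ↦ hJ fun n ↦ u n k

/-- A random linear functional whose norm is bounded by the square root of an integrable random
variable extends to a Hilbert-Schmidt map. -/
theorem exists_extension_of_random_bound (hd : DenseRange ι) {F : W → Ω → ℝ}
    (hF : ∀ w, AEStronglyMeasurable (F w) P) {Z : Ω → ℝ} (hZ : Integrable Z P) {C : ℝ}
    (hC : ∫ ω, Z ω ∂P ≤ C)
    (h : ∀ᵐ ω ∂P, 0 ≤ Z ω ∧ ∃ ℓ : W →ₗ[ℝ] ℝ, (∀ w, F w ω = ℓ w) ∧ ∀ w, |ℓ w| ≤ √(Z ω) * ‖ι w‖) :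
    (∀ w, MemLp (F w) 2 P) ∧ ∃ J : H →L[ℝ] Lp ℝ 2 P, (∀ w, J (ι w) =ᵐ[P] F w) ∧
      (∀ x, ‖J x‖ ≤ √C * ‖x‖) ∧
      ∀ {β : Type _} (s : Finset β) (b : β → H), Orthonormal ℝ b → ∀ w : β → W,
        ∑ n ∈ s, ‖J (ι (w n))‖ ^ 2 ≤ C * (1 + √(∑ n ∈ s, ‖ι (w n) - b n‖ ^ 2)) ^ 2 := by
  have hC0 : 0 ≤ C := (integral_nonneg_of_ae (h.mono fun ω hω ↦ hω.1)).trans hC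
  have hsq : ∀ w, ∀ᵐ ω ∂P, F w ω ^ 2 ≤ Z ω * ‖ι w‖ ^ 2 := by
    intro w
    filter_upwards [h] with ω ⟨h0, ℓ, h1, h2⟩
    rw [h1, ← sq_abs, ← Real.sq_sqrt h0, ← mul_pow]
    exact pow_le_pow_left₀ (abs_nonneg _) (h2 w) 2
  have hmem : ∀ w, MemLp (F w) 2 P := by
    intro w
    rw [memLp_two_iff_integrable_sq (hF w)]
    refine (hZ.mul_const (‖ι w‖ ^ 2)).mono' ((hF w).pow 2) ?_
    filter_upwards [hsq w] with ω hω
    rwa [Real.norm_of_nonneg (sq_nonneg _)]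
  have hbound : ∀ w, ∀ hw : MemLp (F w) 2 P, ‖hw.toLp (F w)‖ ≤ √C * ‖ι w‖ := by
    intro w hw
    have h1 : ‖hw.toLp (F w)‖ ^ 2 ≤ C * ‖ι w‖ ^ 2 := by
      rw [norm_sq_eq_integral]
      calc ∫ ω, (hw.toLp (F w)) ω ^ 2 ∂P = ∫ ω, F w ω ^ 2 ∂P :=
            integral_congr_ae (hw.coeFn_toLp.mono fun ω hω ↦ by simp only [hω])
        _ ≤ ∫ ω, Z ω * ‖ι w‖ ^ 2 ∂P :=
            integral_mono_ae hw.integrable_sq (hZ.mul_const _) (hsq w)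
        _ ≤ C * ‖ι w‖ ^ 2 := by
            rw [integral_mul_const]
            gcongr
    rw [← Real.sqrt_sq (norm_nonneg (ι w)), ← Real.sqrt_mul hC0]
    exact Real.le_sqrt_of_sq_le h1
  obtain ⟨J, hJ, hJn⟩ := exists_extension hd hmem
    (fun w w' ↦ by
      filter_upwards [h] with ω ⟨_, ℓ, h1, _⟩
      simp [h1])
    (fun c w ↦ by
      filter_upwards [h] with ω ⟨_, ℓ, h1, _⟩
      simp [h1]) hbound
  refine ⟨hmem, J, hJ, hJn, fun s b hb w ↦ ?_⟩
  set δ := √(∑ n ∈ s, ‖ι (w n) - b n‖ ^ 2)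
  calc ∑ n ∈ s, ‖J (ι (w n))‖ ^ 2 = ∑ n ∈ s, ∫ ω, F (w n) ω ^ 2 ∂P := by
        refine Finset.sum_congr rfl fun n _ ↦ ?_
        rw [norm_sq_eq_integral]
        exact integral_congr_ae ((hJ (w n)).mono fun ω hω ↦ by simp only [hω])
    _ = ∫ ω, ∑ n ∈ s, F (w n) ω ^ 2 ∂P :=
        (integral_finsetSum _ fun n _ ↦ (hmem (w n)).integrable_sq).symm
    _ ≤ ∫ ω, Z ω * (1 + δ) ^ 2 ∂P := by
        refine integral_mono_ae (integrable_finsetSum _ fun n _ ↦ (hmem (w n)).integrable_sq)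
          (hZ.mul_const _) ?_
        filter_upwards [h] with ω ⟨h0, ℓ, h1, h2⟩
        -- Bessel's inequality is used for each `ω` before integration, so the constant does not
        -- grow with the size of `s`.
        have h3 := sum_sq_le_of_bound (Real.sqrt_nonneg (Z ω)) h2 s hb w
        rw [Real.sq_sqrt h0] at h3
        simpa only [h1] using h3
    _ ≤ C * (1 + δ) ^ 2 := by
        rw [integral_mul_const]
        gcongr

/-- The limit, in probability, of random linear functionals that are bounded in `L²`. -/
theorem exists_random_functionals [CompleteSpace H] [IsProbabilityMeasure P] (hd : DenseRange ι)
    {κ : Type*} {l : Filter κ} [l.NeBot] [l.IsCountablyGenerated] {U : Set κ} (hU : U ∈ l)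
    {F : κ → W → Ω → ℝ} (hF : ∀ i w, AEStronglyMeasurable (F i w) P) {I : W → Ω → ℝ}
    (hI : ∀ w, TendstoInMeasure P (fun i ↦ F i w) l (I w)) {Z : κ → Ω → ℝ} {C : ℝ}
    (hZ : ∀ i ∈ U, Integrable (Z i) P ∧ ∫ ω, Z i ω ∂P ≤ C)
    (h : ∀ i ∈ U, ∀ᵐ ω ∂P, 0 ≤ Z i ω ∧
      ∃ ℓ : W →ₗ[ℝ] ℝ, (∀ w, F i w ω = ℓ w) ∧ ∀ w, |ℓ w| ≤ √(Z i ω) * ‖ι w‖) :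
    ∃ (Ji : κ → H →L[ℝ] Lp ℝ 2 P) (J : H →L[ℝ] Lp ℝ 2 P),
      (∀ i ∈ U, (∀ w, MemLp (F i w) 2 P) ∧ ∀ w, Ji i (ι w) =ᵐ[P] F i w) ∧
      ((∀ w, MemLp (I w) 2 P) ∧ ∀ w, J (ι w) =ᵐ[P] I w) ∧
      (∀ x, TendstoInMeasure P (fun i ↦ (Ji i x : Ω → ℝ)) l (J x) ∧
        ∀ p : ℝ, 0 < p → p < 2 →
          Tendsto (fun i ↦ eLpNorm (fun ω ↦ Ji i x ω - J x ω) (ENNReal.ofReal p) P) l (𝓝 0)) ∧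
      ∃ (ξi : κ → Lp H 2 P) (ξ : Lp H 2 P),
        (∀ i ∈ U, ∀ x, Ji i x =ᵐ[P] fun ω ↦ inner ℝ (ξi i ω) x) ∧
        ∀ x, J x =ᵐ[P] fun ω ↦ inner ℝ (ξ ω) x := by
  classical
  have hex := fun i (hi : i ∈ U) ↦
    exists_extension_of_random_bound hd (hF i) (hZ i hi).1 (hZ i hi).2 (h i hi)
  -- Zero outside `U` is a default value, invisible along `l` since `U ∈ l`.
  set Ji : κ → H →L[ℝ] Lp ℝ 2 P := fun i ↦ if hi : i ∈ U then (hex i hi).2.choose else 0 with hJi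
  have hspec : ∀ i ∈ U, (∀ w, Ji i (ι w) =ᵐ[P] F i w) ∧ (∀ x, ‖Ji i x‖ ≤ √C * ‖x‖) ∧
      ∀ {β : Type _} (s : Finset β) (b : β → H), Orthonormal ℝ b → ∀ w : β → W,
        ∑ n ∈ s, ‖Ji i (ι (w n))‖ ^ 2 ≤ C * (1 + √(∑ n ∈ s, ‖ι (w n) - b n‖ ^ 2)) ^ 2 := by
    intro i hi
    simp only [hJi, dif_pos hi]
    exact (hex i hi).2.choose_spec
  have hlim : ∀ w, TendstoInMeasure P (fun i ↦ (Ji i (ι w) : Ω → ℝ)) l (I w) := fun w ↦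
    (hI w).congr' (mem_of_superset hU fun i hi ↦ ((hspec i hi).1 w).symm) ae_eq_rfl
  have heL : ∀ w, eLpNorm (I w) 2 P ≤ ENNReal.ofReal (√C * ‖ι w‖) := by
    intro w
    refine eLpNorm_le_of_tendstoInMeasure (mem_of_superset hU fun i hi ↦ ?_) (hlim w)
      fun i ↦ Lp.aestronglyMeasurable _
    rw [Set.mem_ofPred_eq, ← Lp.enorm_def, ← ofReal_norm]
    exact ENNReal.ofReal_le_ofReal ((hspec i hi).2.1 _)
  have hImem : ∀ w, MemLp (I w) 2 P := fun w ↦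
    ⟨(hlim w).aestronglyMeasurable fun i ↦ Lp.aestronglyMeasurable _,
      (heL w).trans_lt ENNReal.ofReal_lt_top⟩
  -- `I` is given only as a limit for each `w`; its almost sure linearity comes from uniqueness of
  -- limits in measure.
  obtain ⟨J, hJ, hJn⟩ := exists_extension hd hImem (C := √C)
    (fun w w' ↦ by
      refine tendstoInMeasure_ae_unique (hlim (w + w')) ?_
      refine TendstoInMeasure.congr_left (f := fun i ω ↦ Ji i (ι w) ω + Ji i (ι w') ω)
        (fun i ↦ ?_) ?_
      · rw [map_add, map_add]
        exact (Lp.coeFn_add _ _).symm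
      · refine tendstoInMeasure_of_norm_le_sum Finset.univ
          (f := ![fun i ↦ (Ji i (ι w) : Ω → ℝ), fun i ↦ (Ji i (ι w') : Ω → ℝ)])
          (g := ![I w, I w']) (fun k _ ↦ ?_) one_pos fun i ω ↦ ?_
        · fin_cases k
          · exact hlim w
          · exact hlim w'
        · rw [Fin.sum_univ_two, one_mul, Pi.add_apply, add_sub_add_comm]
          exact norm_add_le _ _)
    (fun c w ↦ by
      refine tendstoInMeasure_ae_unique (hlim (c • w)) ?_
      refine TendstoInMeasure.congr_left (f := fun i ω ↦ c • Ji i (ι w) ω) (fun i ↦ ?_) ?_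
      · rw [map_smul, map_smul]
        exact (Lp.coeFn_smul c (Ji i (ι w))).symm
      · refine tendstoInMeasure_of_norm_le_sum Finset.univ
          (f := fun (_ : Fin 1) i ↦ (Ji i (ι w) : Ω → ℝ))
          (g := fun _ ↦ I w) (fun k _ ↦ hlim w) (C := |c| + 1) (by positivity) fun i ω ↦ ?_
        rw [Fin.sum_univ_one, Pi.smul_apply, ← smul_sub, norm_smul, Real.norm_eq_abs c]
        gcongr
        linarith)
    (fun w hw ↦ by
      rw [Lp.norm_toLp]
      exact ENNReal.toReal_le_of_le_ofReal (by positivity) (heL w))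
  have hconv : ∀ x, TendstoInMeasure P (fun i ↦ (Ji i x : Ω → ℝ)) l (J x) := by
    intro x
    refine tendstoInMeasure_of_approx (fun i ↦ Lp.aestronglyMeasurable _)
      (Lp.aestronglyMeasurable _) fun δ hδ ↦ ?_
    -- The `+ 1` allows `C = 0`.
    have hδ' : 0 < δ / (√C + 1) := by positivity
    obtain ⟨w, hw⟩ := hd.exists_dist_lt x hδ'
    have hxw : √C * ‖x - ι w‖ ≤ δ := by
      rw [dist_eq_norm, lt_div_iff₀ (by positivity)] at hw
      nlinarith [norm_nonneg (x - ι w)]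
    refine ⟨fun i ↦ Ji i (ι w), J (ι w), (hlim w).congr_right (hJ w).symm,
      fun i ↦ Lp.aestronglyMeasurable _, Lp.aestronglyMeasurable _,
      mem_of_superset hU fun i hi ↦ ?_, ?_⟩
    · rw [Set.mem_ofPred_eq, ← eLpNorm_congr_ae (Lp.coeFn_sub (Ji i x) (Ji i (ι w))),
        ← Lp.enorm_def, ← ofReal_norm, ← map_sub]
      exact ENNReal.ofReal_le_ofReal (((hspec i hi).2.1 _).trans hxw)
    · rw [← eLpNorm_congr_ae (Lp.coeFn_sub (J (ι w)) (J x)),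
        ← Lp.enorm_def, ← ofReal_norm, ← map_sub]
      refine ENNReal.ofReal_le_ofReal ((hJn _).trans ?_)
      rwa [norm_sub_rev]
  have hHS : ∀ i ∈ U, ∀ (w : Set H) (b : w → H), Orthonormal ℝ b → ∀ s : Finset w,
      ∑ n ∈ s, ‖Ji i (b n)‖ ^ 2 ≤ C := fun i hi w b hb s ↦
    sum_norm_sq_le_of_approx hd s fun u ↦ (hspec i hi).2.2 s b hb u
  have hHSlim : ∀ (w : Set H) (b : w → H), Orthonormal ℝ b → ∀ s : Finset w,
      ∑ n ∈ s, ‖J (b n)‖ ^ 2 ≤ C := by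
    intro w b hb s
    refine sum_norm_sq_le_of_tendstoInMeasure hb s (f := fun n i ↦ Ji i (b n))
      (fun n _ ↦ hconv (b n)) (mem_of_superset hU fun i hi ↦ hHS i hi w b hb s)
  have hξ := fun i (hi : i ∈ U) ↦ exists_random_vector (Ji i) (hHS i hi)
  obtain ⟨ξ, hξlim⟩ := exists_random_vector J hHSlim
  refine ⟨Ji, J, fun i hi ↦ ⟨(hex i hi).1, (hspec i hi).1⟩, ⟨hImem, hJ⟩, fun x ↦ ⟨hconv x, ?_⟩,
    fun i ↦ if hi : i ∈ U then (hξ i hi).choose else 0, ξ, fun i hi ↦ ?_, hξlim⟩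
  · intro p hp hp2
    refine tendsto_eLpNorm_of_tendstoInMeasure (hconv x)
      (fun i ↦ (Lp.aestronglyMeasurable _).sub (Lp.aestronglyMeasurable _))
      (M := √C * ‖x‖ + √C * ‖x‖) (mem_of_superset hU fun i hi ↦ ?_) hp hp2
    have e := eLpNorm_congr_ae (p := 2) (Lp.coeFn_sub (Ji i x) (J x))
    change eLpNorm (⇑(Ji i x) - ⇑(J x)) 2 P ≤ _
    rw [← e, ← Lp.enorm_def, ← ofReal_norm]
    exact ENNReal.ofReal_le_ofReal ((norm_sub_le _ _).trans
      (add_le_add ((hspec i hi).2.1 x) (hJn x)))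
  · simp only [dif_pos hi]
    exact (hξ i hi).choose_spec

end RandomFunctional

/-! ### Regularized integrals of a continuous process -/

section Paths

variable {Ω : Type*} {d : ℕ}

theorem discreteDeriv_congr {X Y : ℝ≥0 → Ω → RVec d} {ω : Ω} (h : ∀ t, X t ω = Y t ω) (D : Scheme)
    (ε t : ℝ) : discreteDeriv D X ε t ω = discreteDeriv D Y ε t ω := by
  have he : ∀ s, extend X s ω = extend Y s ω := fun s ↦ by simp only [extend, h]
  cases D <;> simp only [discreteDeriv, he]

theorem regIntegral_congr {X Y : ℝ≥0 → Ω → RVec d} {ω : Ω} (h : ∀ t, X t ω = Y t ω) (D : Scheme)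
    (T ε : ℝ) (φ : TestField d) : regIntegral D X T ε φ ω = regIntegral D Y T ε φ ω := by
  have he : ∀ s, extend X s ω = extend Y s ω := fun s ↦ by simp only [extend, h]
  simp only [regIntegral, he, discreteDeriv_congr h D]

theorem measurable_discreteDeriv_of_measurable_extend {S : Type*} [MeasurableSpace S]
    {X : ℝ≥0 → Ω → RVec d} {r : S → ℝ} {o : S → Ω}
    (h : ∀ c : ℝ, Measurable fun p ↦ extend X (r p + c) (o p)) (D : Scheme) (ε : ℝ) :
    Measurable fun p ↦ discreteDeriv D X ε (r p) (o p) := by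
  have h0 : Measurable fun p ↦ extend X (r p) (o p) := by simpa using h 0
  have hn : Measurable fun p ↦ extend X (r p - ε) (o p) := by
    simpa [sub_eq_add_neg] using h (-ε)
  cases D
  · exact ((h ε).sub h0).const_smul ε⁻¹
  · exact (h0.sub hn).const_smul ε⁻¹
  · exact ((h ε).sub hn).const_smul ε⁻¹

theorem measurable_extend_path {X : ℝ≥0 → Ω → RVec d} {ω : Ω} (h : Continuous fun t ↦ X t ω) :
    Measurable fun t : ℝ ↦ extend X t ω := by
  unfold extend
  exact Measurable.ite measurableSet_Ici (h.measurable.comp measurable_real_toNNReal)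
    measurable_const

theorem measurable_discreteDeriv_path {X : ℝ≥0 → Ω → RVec d} {ω : Ω}
    (h : Continuous fun t ↦ X t ω) (D : Scheme) (ε : ℝ) :
    Measurable fun t : ℝ ↦ discreteDeriv D X ε t ω :=
  measurable_discreteDeriv_of_measurable_extend (r := fun t : ℝ ↦ t) (o := fun _ ↦ ω)
    (fun c ↦ (measurable_extend_path h).comp (measurable_id.add_const c)) D ε

/-- The extended path may jump at time `0`, so compactness is used on nonnegative times only. -/
theorem exists_norm_extend_le {X : ℝ≥0 → Ω → RVec d} {ω : Ω} (h : Continuous fun t ↦ X t ω)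
    (R : ℝ) : ∃ M : ℝ, 0 ≤ M ∧ ∀ t ≤ R, ‖extend X t ω‖ ≤ M := by
  obtain ⟨M, hM⟩ := (isCompact_Icc (a := (0 : ℝ≥0)) (b := R.toNNReal)).exists_bound_of_continuousOn
    h.continuousOn
  refine ⟨max M 0, le_max_right _ _, fun t ht ↦ ?_⟩
  unfold extend
  split_ifs
  · exact (hM _ ⟨zero_le, Real.toNNReal_le_toNNReal ht⟩).trans (le_max_left _ _)
  · simp

theorem exists_norm_discreteDeriv_le {X : ℝ≥0 → Ω → RVec d} {ω : Ω}
    (h : Continuous fun t ↦ X t ω) (D : Scheme) (T ε : ℝ) :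
    ∃ M : ℝ, ∀ᵐ t ∂volume.restrict (Set.Ioc 0 T), ‖discreteDeriv D X ε t ω‖ ≤ M := by
  obtain ⟨M, hM0, hM⟩ := exists_norm_extend_le h (T + |ε|)
  refine ⟨|ε⁻¹| * (M + M), (ae_restrict_mem measurableSet_Ioc).mono fun t ht ↦ ?_⟩
  have h0 := hM t (by linarith [ht.2, abs_nonneg ε])
  have h1 := hM (t + ε) (by linarith [ht.2, le_abs_self ε])
  have h2 := hM (t - ε) (by linarith [ht.2, neg_abs_le ε])
  cases D <;>
  · simp only [discreteDeriv, norm_smul, Real.norm_eq_abs]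
    gcongr
    exact (norm_sub_le _ _).trans (add_le_add ‹_› ‹_›)

/-- The regularized integral, along a fixed path, as a linear functional of the test field. -/
theorem exists_linearMap_regIntegral {X : ℝ≥0 → Ω → RVec d} {ω : Ω}
    (h : Continuous fun t ↦ X t ω) (D : Scheme) {T : ℝ} (hT : 0 ≤ T) (ε : ℝ) :
    ∃ ℓ : testSubmodule d →ₗ[ℝ] ℝ, ∀ φ, regIntegral D X T ε (toTestField φ) ω = ℓ φ := by
  obtain ⟨M, hM⟩ := exists_norm_discreteDeriv_le h D T ε
  have hint : ∀ φ : testSubmodule d, Integrable (fun t ↦ inner ℝ ((φ : RVec d → RVec d)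
      (extend X t ω)) (discreteDeriv D X ε t ω)) (volume.restrict (Set.Ioc 0 T)) := by
    intro φ
    obtain ⟨B, hB⟩ := φ.2.2.exists_bound_of_continuous φ.2.1.continuous
    have hm : Measurable fun t ↦ inner ℝ ((φ : RVec d → RVec d) (extend X t ω))
        (discreteDeriv D X ε t ω) :=
      (φ.2.1.continuous.measurable.comp (measurable_extend_path h)).inner
        (measurable_discreteDeriv_path h D ε)
    refine Integrable.of_bound hm.aestronglyMeasurable (B * M) ?_
    filter_upwards [hM] with t ht
    exact (norm_inner_le_norm _ _).trans (mul_le_mul (hB _) ht (norm_nonneg _)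
      ((norm_nonneg _).trans (hB 0)))
  refine ⟨{ toFun := fun φ ↦ ∫ t in Set.Ioc 0 T, inner ℝ ((φ : RVec d → RVec d) (extend X t ω))
              (discreteDeriv D X ε t ω)
            map_add' := fun φ ψ ↦ ?_
            map_smul' := fun c φ ↦ ?_ }, fun φ ↦ intervalIntegral.integral_of_le hT⟩
  · rw [← integral_add (hint φ) (hint ψ)]
    congr 1
    funext t
    exact inner_add_left _ _ _
  · rw [RingHom.id_apply, smul_eq_mul, ← integral_const_mul]
    congr 1
    funext t
    exact real_inner_smul_left _ _ _

/-- The energy along a fixed path is nonnegative, and controls the regularized integrals. -/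
theorem regIntegral_le_of_path {X : ℝ≥0 → Ω → RVec d} {ω : Ω} (h : Continuous fun t ↦ X t ω)
    (D : Scheme) {T α : ℝ} (hT : 0 ≤ T) (hα : 0 < α) (hB : (∫⁻ s in Set.Icc 0 T,
      ∫⁻ t in Set.Icc 0 T, besselKernelHat d α (extend X t ω - extend X s ω)) < ∞) (ε : ℝ) :
    0 ≤ energy D X T α ε ω ∧
      ∀ φ, |regIntegral D X T ε φ ω| ≤ √(energy D X T α ε ω) * ‖φ.toSobolev α‖ := by
  obtain ⟨M, hM⟩ := exists_norm_discreteDeriv_le h D T ε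
  have hx := measurable_extend_path h
  have hv := measurable_discreteDeriv_path h D ε
  rw [← Measure.restrict_congr_set Ioc_ae_eq_Icc] at hB
  have he : energy D X T α ε ω = ∫ p, energyDensity α (fun t ↦ extend X t ω)
      (fun t ↦ discreteDeriv D X ε t ω) p
      ∂((volume.restrict (Set.Ioc 0 T)).prod (volume.restrict (Set.Ioc 0 T))) := by
    rw [integral_prod _ (integrable_energyDensity hα hx hv hM hB), energy,
      intervalIntegral.integral_of_le hT]
    congr 1
    funext s
    exact intervalIntegral.integral_of_le hT
  rw [he]
  refine ⟨(lintegral_symbol_mul_norm_sq_pathFourier hα hx hv hM hB).2, fun φ ↦ ?_⟩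
  rw [regIntegral, intervalIntegral.integral_of_le hT]
  exact abs_integral_inner_le hα hx hv hM hB φ

variable [MeasurableSpace Ω]

/-- Joint measurability requires every path to be continuous, so `X` is replaced by `0` on a
measurable null set containing the bad paths; the set of bad paths itself need not be measurable. -/
theorem aestronglyMeasurable_regIntegral {P : Measure Ω} {X : ℝ≥0 → Ω → RVec d}
    (hX : ∀ t, Measurable (X t)) (hXc : ∀ᵐ ω ∂P, Continuous (fun t ↦ X t ω)) (D : Scheme) {T : ℝ}
    (hT : 0 ≤ T) (ε : ℝ) (φ : TestField d) :
    AEStronglyMeasurable (regIntegral D X T ε φ) P := by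
  set N := toMeasurable P {ω | ¬ Continuous (fun t ↦ X t ω)} with hN
  have hN0 : P N = 0 := by
    rw [hN, measure_toMeasurable]
    exact hXc
  have hNm : MeasurableSet N := measurableSet_toMeasurable _ _
  set Y : ℝ≥0 → Ω → RVec d := fun t ↦ Nᶜ.indicator (X t) with hY
  have hYm : ∀ t, Measurable (Y t) := fun t ↦ (hX t).indicator hNm.compl
  have hYc : ∀ ω, Continuous fun t ↦ Y t ω := by
    intro ω
    by_cases hω : ω ∈ N
    · simpa [hY, hω] using continuous_const
    · have : Continuous fun t ↦ X t ω := by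
        by_contra hc
        exact hω (subset_toMeasurable _ _ hc)
      simpa [hY, hω] using this
  have hjoint : Measurable (Function.uncurry Y) :=
    measurable_uncurry_of_continuous_of_measurable hYc hYm
  have hext : ∀ c : ℝ, Measurable fun p : Ω × ℝ ↦ extend Y (p.2 + c) p.1 := by
    intro c
    unfold extend
    have h1 : Measurable fun p : Ω × ℝ ↦ Y (p.2 + c).toNNReal p.1 :=
      hjoint.comp ((measurable_real_toNNReal.comp (measurable_snd.add_const c)).prodMk
        measurable_fst)
    exact Measurable.ite (measurableSet_le measurable_const (measurable_snd.add_const c)) h1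
      measurable_const
  have hD := measurable_discreteDeriv_of_measurable_extend (r := fun p : Ω × ℝ ↦ p.2)
    (o := fun p ↦ p.1) hext D ε
  have hE : Measurable fun p : Ω × ℝ ↦ extend Y p.2 p.1 := by simpa using hext 0
  have hI : Measurable fun p : Ω × ℝ ↦
      inner ℝ (φ.toFun (extend Y p.2 p.1)) (discreteDeriv D Y ε p.2 p.1) :=
    (φ.smooth.continuous.measurable.comp hE).inner hD
  have hS : StronglyMeasurable (regIntegral D Y T ε φ) := by
    have h1 := hI.stronglyMeasurable.integral_prod_right' (ν := volume.restrict (Set.Ioc 0 T))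
    convert h1 using 1
    funext ω
    exact intervalIntegral.integral_of_le hT
  refine hS.aestronglyMeasurable.congr ?_
  have hae : ∀ᵐ ω ∂P, ω ∉ N := measure_eq_zero_iff_ae_notMem.1 hN0
  filter_upwards [hae] with ω hω
  exact regIntegral_congr (fun t ↦ by simp [hY, hω]) D T ε φ

/-- The exceptional null set does not depend on `φ`; linearity and the bound must hold for all test
fields at the same `ω`. -/
theorem exists_random_linearMap {P : Measure Ω} {X : ℝ≥0 → Ω → RVec d}
    (hXc : ∀ᵐ ω ∂P, Continuous (fun t ↦ X t ω)) (D : Scheme) {T α : ℝ} (hT : 0 ≤ T) (hα : 0 < α)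
    (hB : KernelIntegrable P X T α) (ε : ℝ) :
    ∀ᵐ ω ∂P, 0 ≤ energy D X T α ε ω ∧ ∃ ℓ : testSubmodule d →ₗ[ℝ] ℝ,
      (∀ φ, regIntegral D X T ε (toTestField φ) ω = ℓ φ) ∧
      ∀ φ, |ℓ φ| ≤ √(energy D X T α ε ω) * ‖besselTest d α φ‖ := by
  filter_upwards [hXc, hB] with ω hc hb
  obtain ⟨h0, hle⟩ := regIntegral_le_of_path hc D hT hα hb ε
  obtain ⟨ℓ, hℓ⟩ := exists_linearMap_regIntegral hc D hT ε
  refine ⟨h0, ℓ, hℓ, fun φ ↦ ?_⟩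
  rw [← hℓ, besselTest_apply, LinearIsometryEquiv.norm_map]
  exact hle _

/-! ### Return from `realL2 d` to the Sobolev spaces -/

/-- An extension from the test fields to `H_2^α` is unique. -/
theorem isUniqueExtension_of_extends {P : Measure Ω} {α : ℝ} {F : TestField d → Ω → ℝ}
    {J : Sobolev d α →L[ℝ] Lp ℝ 2 P} (hF : ∀ φ, MemLp (F φ) 2 P)
    (hJ : ∀ φ : TestField d, J (φ.toSobolev α) =ᵐ[P] F φ) : IsUniqueExtension P α F J := by
  refine ⟨hF, hJ, fun J' hJ' ↦ ?_⟩
  have hd : DenseRange fun φ : testSubmodule d ↦ (toTestField φ).toSobolev α := by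
    have h1 := (sobolevEquiv d α).symm.surjective.denseRange.comp (denseRange_besselTest d α)
      (sobolevEquiv d α).symm.continuous
    convert h1 using 1
    funext φ
    simp [besselTest_apply]
  refine DFunLike.coe_injective (hd.equalizer J'.continuous J.continuous ?_)
  funext φ
  exact Lp.ext ((hJ' _).trans (hJ _).symm)

/-- A random vector representing a random functional, as a random element of `H_2^{-α}`. -/
theorem isPathwiseRedefinition_of_inner {P : Measure Ω} {α : ℝ} {F : TestField d → Ω → ℝ}
    {J : Sobolev d α →L[ℝ] Lp ℝ 2 P} (hJ : ∀ φ : TestField d, J (φ.toSobolev α) =ᵐ[P] F φ)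
    (ξ : Lp (realL2 d) 2 P)
    (hξ : ∀ φ, J φ =ᵐ[P] fun ω ↦ inner ℝ (ξ ω) (sobolevEquiv d α φ)) :
    IsPathwiseRedefinition P α F J fun ω ↦ (sobolevEquiv d (-α)).symm (ξ ω) := by
  have h : ∀ φ : Sobolev d α, ∀ᵐ ω ∂P,
      J φ ω = Sobolev.dualPairing d α ((sobolevEquiv d (-α)).symm (ξ ω)) φ := by
    intro φ
    filter_upwards [hξ φ] with ω hω
    rw [hω, dualPairing_eq_inner, LinearIsometryEquiv.apply_symm_apply]
  refine ⟨(sobolevEquiv d (-α)).symm.continuous.comp_stronglyMeasurable (Lp.stronglyMeasurable ξ),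
    ?_, fun φ ↦ ?_, h⟩
  · refine (Lp.memLp ξ).of_le ((sobolevEquiv d (-α)).symm.continuous.comp_stronglyMeasurable
      (Lp.stronglyMeasurable ξ)).aestronglyMeasurable (Eventually.of_forall fun ω ↦ ?_)
    rw [LinearIsometryEquiv.norm_map]
  · filter_upwards [h (φ.toSobolev α), hJ φ] with ω h1 h2
    rw [← h2, h1, dualPairing_toSobolev]

end Paths

end StochasticCurrents

end

open StochasticCurrents
theorem mainTheorem1 {Ω : Type*} [MeasurableSpace Ω] (P : Measure Ω) [IsProbabilityMeasure P]
    (d : ℕ) (X : ℝ≥0 → Ω → RVec d) (hX : ∀ t, Measurable (X t))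
    (hXc : ∀ᵐ ω ∂P, Continuous (fun t ↦ X t ω))
    (D : Scheme) (T : ℝ) (hT : 0 < T) (α : ℝ) (hα : 0 < α)
    (I : TestField d → Ω → ℝ)
    (hA : RegIntegralsConverge P D X T I)
    (hB : KernelIntegrable P X T α)
    (hZ : ∃ C : ℝ, ∀ ε ∈ Set.Ioo (0 : ℝ) 1,
      Integrable (energy D X T α ε) P ∧ ∫ ω, energy D X T α ε ω ∂P ≤ C) :
    ∃ (Jε : ℝ → (Sobolev d α →L[ℝ] Lp ℝ 2 P)) (J : Sobolev d α →L[ℝ] Lp ℝ 2 P),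
      (∀ ε ∈ Set.Ioo (0 : ℝ) 1, IsUniqueExtension P α (regIntegral D X T ε) (Jε ε)) ∧
      IsUniqueExtension P α I J ∧
      (∀ φ : Sobolev d α,
        TendstoInMeasure P (fun ε ↦ (Jε ε φ : Ω → ℝ)) (𝓝[>] (0 : ℝ)) (J φ) ∧
        ∀ δ : ℝ, 0 < δ → δ < 2 →
          Tendsto (fun ε ↦ eLpNorm (fun ω ↦ Jε ε φ ω - J φ ω) (ENNReal.ofReal (2 - δ)) P)
            (𝓝[>] (0 : ℝ)) (𝓝 0)) ∧
      ∃ (ξε : ℝ → Ω → Sobolev d (-α)) (ξ : Ω → Sobolev d (-α)),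
        (∀ ε ∈ Set.Ioo (0 : ℝ) 1,
          IsPathwiseRedefinition P α (regIntegral D X T ε) (Jε ε) (ξε ε)) ∧
        IsPathwiseRedefinition P α I J ξ := by
  obtain ⟨C, hC⟩ := hZ
  obtain ⟨Ji, J, hJi, hJ, hconv, ξi, ξ, hξi, hξ⟩ := exists_random_functionals
    (denseRange_besselTest d α) (l := 𝓝[>] (0 : ℝ)) (Ioo_mem_nhdsGT one_pos)
    (F := fun ε φ ↦ regIntegral D X T ε (toTestField φ))
    (fun ε φ ↦ aestronglyMeasurable_regIntegral hX hXc D hT.le ε _)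
    (I := fun φ ↦ I (toTestField φ)) (fun φ ↦ (hA _).2) hC
    (fun ε _ ↦ exists_random_linearMap hXc D hT.le hα hB ε)
  -- The abstract result lives on `realL2 d`; composition with `(1 - Δ)^{α/2}` brings the
  -- functionals back to `H_2^α`.
  let e : Sobolev d α →L[ℝ] realL2 d := (sobolevEquiv d α).toContinuousLinearEquiv
  have hJi' : ∀ ε ∈ Set.Ioo (0 : ℝ) 1, ∀ φ : TestField d,
      ((Ji ε).comp e) (φ.toSobolev α) =ᵐ[P] regIntegral D X T ε φ := fun ε hε φ ↦
    (hJi ε hε).2 ⟨φ.toFun, φ.smooth, φ.compactSupport⟩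
  have hJ' : ∀ φ : TestField d, (J.comp e) (φ.toSobolev α) =ᵐ[P] I φ := fun φ ↦
    hJ.2 ⟨φ.toFun, φ.smooth, φ.compactSupport⟩
  refine ⟨fun ε ↦ (Ji ε).comp e, J.comp e, fun ε hε ↦ isUniqueExtension_of_extends
    (fun φ ↦ (hJi ε hε).1 ⟨φ.toFun, φ.smooth, φ.compactSupport⟩) (hJi' ε hε),
    isUniqueExtension_of_extends (fun φ ↦ hJ.1 ⟨φ.toFun, φ.smooth, φ.compactSupport⟩) hJ',
    fun φ ↦ ⟨(hconv (e φ)).1, fun δ h0 h2 ↦ (hconv (e φ)).2 (2 - δ) (by linarith) (by linarith)⟩,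
    fun ε ω ↦ (sobolevEquiv d (-α)).symm (ξi ε ω), fun ω ↦ (sobolevEquiv d (-α)).symm (ξ ω),
    fun ε hε ↦ ?_, ?_⟩
  · exact isPathwiseRedefinition_of_inner (hJi' ε hε) (ξi ε) fun φ ↦ hξi ε hε (e φ)
  · exact isPathwiseRedefinition_of_inner hJ' ξ fun φ ↦ hξ (e φ)
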